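/- Work in the cubical type theory with a Russell-style universe $\mathsf{U}$, i.e. Martin-Löf type theory with $\Pi$-types, $\Sigma$-types (both with $\eta$) and natural numbers, extended by an interval $\mathbb{I}$ (the free de Morgan algebra on names), path types, face formulas $\varphi$ in the face lattice $\mathbb{F}$ with context restrictions $\Gamma,\varphi$ and systems, a composition operation $\mathsf{comp}^i\,A\,[\varphi\mapsto u]\,a_0$ with its computation rules for every type former, and glueing types $\mathsf{Glue}\,[\varphi\mapsto(T,f)]\,A$. Put \begin{align*} \mathsf{isContr}\,A &= (x : A)\times\big((y : A)\to \mathsf{Path}\,A\,x\,y\big),\\ \mathsf{isEquiv}\,T\,A\,f &= (y : A)\to \mathsf{isContr}\big((x : T)\times \mathsf{Path}\,A\,y\,(f\,x)\big),\\ \mathsf{Equiv}\,T\,A &= (f : T\to A)\times \mathsf{isEquiv}\,T\,A\,f . \end{align*} For every context $\Gamma$ and every term $A$ with $\Gamma\vdash A:\mathsf{U}$, the type $(X:\mathsf{U})\times\mathsf{Equiv}\,X\,A$ is contractible: there is a term $t$ such that $$\Gamma\vdash t : \mathsf{isContr}\big((X:\mathsf{U})\times \mathsf{Equiv}\,X\,A\big)$$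 is derivable. -/

import Mathlib

/-!  Cubical type theory (with a universe) as a deductive system.

The syntax is well scoped and uses de Bruijn indices.  `Tm n m` are the raw terms and types
with `n` term variables and `m` dimension names; the two kinds of variables are
numbered separately, index `0` being the one declared last.  -/

namespace Cubical

/-! ### The interval: the free de Morgan algebra on `m` names -/

inductive DimExpr (m : ℕ) : Type
  | zero : DimExpr m
  | one : DimExpr m
  | var : Fin m → DimExpr m
  | neg : DimExpr m → DimExpr m
  | inf : DimExpr m → DimExpr m → DimExpr m
  | sup : DimExpr m → DimExpr m → DimExpr m

/-- Provable equality from the axioms of de Morgan algebras. -/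
inductive DimExpr.Rel {m : ℕ} : DimExpr m → DimExpr m → Prop
  | refl (a) : Rel a a
  | symm {a b} : Rel a b → Rel b a
  | trans {a b c} : Rel a b → Rel b c → Rel a c
  | neg {a b} : Rel a b → Rel (.neg a) (.neg b)
  | inf {a a' b b'} : Rel a a' → Rel b b' → Rel (.inf a b) (.inf a' b')
  | sup {a a' b b'} : Rel a a' → Rel b b' → Rel (.sup a b) (.sup a' b')
  | inf_comm (a b) : Rel (.inf a b) (.inf b a)
  | sup_comm (a b) : Rel (.sup a b) (.sup b a)
  | inf_assoc (a b c) : Rel (.inf (.inf a b) c) (.inf a (.inf b c))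
  | sup_assoc (a b c) : Rel (.sup (.sup a b) c) (.sup a (.sup b c))
  | inf_sup_self (a b) : Rel (.inf a (.sup a b)) a
  | sup_inf_self (a b) : Rel (.sup a (.inf a b)) a
  | inf_sup_left (a b c) : Rel (.inf a (.sup b c)) (.sup (.inf a b) (.inf a c))
  | zero_sup (a) : Rel (.sup .zero a) a
  | one_inf (a) : Rel (.inf .one a) a
  | neg_neg (a) : Rel (.neg (.neg a)) a
  | neg_zero : Rel (.neg .zero) .one
  | neg_one : Rel (.neg .one) .zero
  | neg_sup (a b) : Rel (.neg (.sup a b)) (.inf (.neg a) (.neg b))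
  | neg_inf (a b) : Rel (.neg (.inf a b)) (.sup (.neg a) (.neg b))

instance DimExpr.setoid (m : ℕ) : Setoid (DimExpr m) where
  r := DimExpr.Rel
  iseqv := ⟨.refl, .symm, .trans⟩

/-- The interval `𝕀` on `m` names; the end points are `⊥` and `⊤`. -/
def Dim (m : ℕ) : Type := Quotient (DimExpr.setoid m)

namespace Dim

variable {m : ℕ}

def var (i : Fin m) : Dim m := Quotient.mk _ (.var i)

/-- The involution `1 - r`. -/
def neg : Dim m → Dim m := Quotient.map .neg fun _ _ h => .neg h

instance : DistribLattice (Dim m) :=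
  letI : Max (Dim m) := ⟨Quotient.map₂ .sup fun _ _ h _ _ h' => .sup h h'⟩
  letI : Min (Dim m) := ⟨Quotient.map₂ .inf fun _ _ h _ _ h' => .inf h h'⟩
  letI : Lattice (Dim m) := Lattice.mk'
    (by rintro ⟨a⟩ ⟨b⟩; exact Quotient.sound (.sup_comm a b))
    (by rintro ⟨a⟩ ⟨b⟩ ⟨c⟩; exact Quotient.sound (.sup_assoc a b c))
    (by rintro ⟨a⟩ ⟨b⟩; exact Quotient.sound (.inf_comm a b))
    (by rintro ⟨a⟩ ⟨b⟩ ⟨c⟩; exact Quotient.sound (.inf_assoc a b c))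
    (by rintro ⟨a⟩ ⟨b⟩; exact Quotient.sound (.sup_inf_self a b))
    (by rintro ⟨a⟩ ⟨b⟩; exact Quotient.sound (.inf_sup_self a b))
  DistribLattice.ofInfSupLe
    (by rintro ⟨a⟩ ⟨b⟩ ⟨c⟩; exact le_of_eq (Quotient.sound (.inf_sup_left a b c)))

instance : BoundedOrder (Dim m) where
  bot := Quotient.mk _ .zero
  bot_le := by
    rintro ⟨a⟩
    exact sup_eq_right.mp (Quotient.sound (.zero_sup a))
  top := Quotient.mk _ .one
  le_top := by
    rintro ⟨a⟩
    exact inf_eq_right.mp (Quotient.sound (.one_inf a))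

theorem neg_neg (r : Dim m) : r.neg.neg = r := by
  rcases r with ⟨a⟩; exact Quotient.sound (.neg_neg a)

theorem neg_bot : (⊥ : Dim m).neg = ⊤ := Quotient.sound .neg_zero

theorem neg_top : (⊤ : Dim m).neg = ⊥ := Quotient.sound .neg_one

theorem neg_sup (r s : Dim m) : (r ⊔ s).neg = r.neg ⊓ s.neg := by
  rcases r with ⟨a⟩; rcases s with ⟨b⟩; exact Quotient.sound (.neg_sup a b)

theorem neg_inf (r s : Dim m) : (r ⊓ s).neg = r.neg ⊔ s.neg := by
  rcases r with ⟨a⟩; rcases s with ⟨b⟩; exact Quotient.sound (.neg_inf a b)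

end Dim

def DimExpr.subst {m m' : ℕ} (ρ : Fin m → Dim m') : DimExpr m → Dim m'
  | zero => ⊥
  | one => ⊤
  | var i => ρ i
  | neg r => (r.subst ρ).neg
  | inf r s => r.subst ρ ⊓ s.subst ρ
  | sup r s => r.subst ρ ⊔ s.subst ρ

theorem DimExpr.subst_rel {m m' : ℕ} (ρ : Fin m → Dim m') {a b : DimExpr m} (h : Rel a b) :
    a.subst ρ = b.subst ρ := by
  induction h with
  | refl => rfl
  | symm _ ih => exact ih.symm
  | trans _ _ ih ih' => exact ih.trans ih'
  | neg _ ih => simp only [subst, ih]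
  | inf _ _ ih ih' => simp only [subst, ih, ih']
  | sup _ _ ih ih' => simp only [subst, ih, ih']
  | inf_comm => exact _root_.inf_comm _ _
  | sup_comm => exact _root_.sup_comm _ _
  | inf_assoc => exact _root_.inf_assoc _ _ _
  | sup_assoc => exact _root_.sup_assoc _ _ _
  | inf_sup_self => exact _root_.inf_sup_self
  | sup_inf_self => exact _root_.sup_inf_self
  | inf_sup_left => exact _root_.inf_sup_left _ _ _
  | zero_sup => exact bot_sup_eq _
  | one_inf => exact top_inf_eq _
  | neg_neg => exact Dim.neg_neg _
  | neg_zero => exact Dim.neg_bot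
  | neg_one => exact Dim.neg_top
  | neg_sup => exact Dim.neg_sup _ _
  | neg_inf => exact Dim.neg_inf _ _

/-- Simultaneous substitution of elements of the interval for names. -/
def Dim.subst {m m' : ℕ} (ρ : Fin m → Dim m') : Dim m → Dim m' :=
  Quotient.lift (DimExpr.subst ρ) fun _ _ h => DimExpr.subst_rel ρ h

/-- Weakening by a new name `0`. -/
def Dim.wk {m : ℕ} (r : Dim m) : Dim (m + 1) := r.subst fun i => .var i.succ

/-! ### The face lattice on `m` names -/

inductive FaceExpr (m : ℕ) : Type
  | bot : FaceExpr m
  | top : FaceExpr m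
  | eq0 : Fin m → FaceExpr m
  | eq1 : Fin m → FaceExpr m
  | inf : FaceExpr m → FaceExpr m → FaceExpr m
  | sup : FaceExpr m → FaceExpr m → FaceExpr m

/-- Provable equality from the axioms of bounded distributive lattices and
`(i = 0) ∧ (i = 1) = 0`. -/
inductive FaceExpr.Rel {m : ℕ} : FaceExpr m → FaceExpr m → Prop
  | refl (a) : Rel a a
  | symm {a b} : Rel a b → Rel b a
  | trans {a b c} : Rel a b → Rel b c → Rel a c
  | inf {a a' b b'} : Rel a a' → Rel b b' → Rel (.inf a b) (.inf a' b')
  | sup {a a' b b'} : Rel a a' → Rel b b' → Rel (.sup a b) (.sup a' b')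
  | inf_comm (a b) : Rel (.inf a b) (.inf b a)
  | sup_comm (a b) : Rel (.sup a b) (.sup b a)
  | inf_assoc (a b c) : Rel (.inf (.inf a b) c) (.inf a (.inf b c))
  | sup_assoc (a b c) : Rel (.sup (.sup a b) c) (.sup a (.sup b c))
  | inf_sup_self (a b) : Rel (.inf a (.sup a b)) a
  | sup_inf_self (a b) : Rel (.sup a (.inf a b)) a
  | inf_sup_left (a b c) : Rel (.inf a (.sup b c)) (.sup (.inf a b) (.inf a c))
  | bot_sup (a) : Rel (.sup .bot a) a
  | top_inf (a) : Rel (.inf .top a) a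
  | eq0_inf_eq1 (i) : Rel (.inf (.eq0 i) (.eq1 i)) .bot

instance FaceExpr.setoid (m : ℕ) : Setoid (FaceExpr m) where
  r := FaceExpr.Rel
  iseqv := ⟨.refl, .symm, .trans⟩

/-- The face lattice `𝔽` on `m` names. -/
def Face (m : ℕ) : Type := Quotient (FaceExpr.setoid m)

namespace Face

variable {m : ℕ}

/-- The generator `(i = 0)`. -/
def eq0 (i : Fin m) : Face m := Quotient.mk _ (.eq0 i)

/-- The generator `(i = 1)`. -/
def eq1 (i : Fin m) : Face m := Quotient.mk _ (.eq1 i)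

instance : DistribLattice (Face m) :=
  letI : Max (Face m) := ⟨Quotient.map₂ .sup fun _ _ h _ _ h' => .sup h h'⟩
  letI : Min (Face m) := ⟨Quotient.map₂ .inf fun _ _ h _ _ h' => .inf h h'⟩
  letI : Lattice (Face m) := Lattice.mk'
    (by rintro ⟨a⟩ ⟨b⟩; exact Quotient.sound (.sup_comm a b))
    (by rintro ⟨a⟩ ⟨b⟩ ⟨c⟩; exact Quotient.sound (.sup_assoc a b c))
    (by rintro ⟨a⟩ ⟨b⟩; exact Quotient.sound (.inf_comm a b))
    (by rintro ⟨a⟩ ⟨b⟩ ⟨c⟩; exact Quotient.sound (.inf_assoc a b c))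
    (by rintro ⟨a⟩ ⟨b⟩; exact Quotient.sound (.sup_inf_self a b))
    (by rintro ⟨a⟩ ⟨b⟩; exact Quotient.sound (.inf_sup_self a b))
  DistribLattice.ofInfSupLe
    (by rintro ⟨a⟩ ⟨b⟩ ⟨c⟩; exact le_of_eq (Quotient.sound (.inf_sup_left a b c)))

instance : BoundedOrder (Face m) where
  bot := Quotient.mk _ .bot
  bot_le := by
    rintro ⟨a⟩
    exact sup_eq_right.mp (Quotient.sound (.bot_sup a))
  top := Quotient.mk _ .top
  le_top := by
    rintro ⟨a⟩
    exact inf_eq_right.mp (Quotient.sound (.top_inf a))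

theorem eq0_inf_eq1 (i : Fin m) : eq0 i ⊓ eq1 i = ⊥ := Quotient.sound (.eq0_inf_eq1 i)

end Face

def FaceExpr.eval {m : ℕ} {L : Type} [DistribLattice L] [BoundedOrder L] (f0 f1 : Fin m → L) :
    FaceExpr m → L
  | bot => ⊥
  | top => ⊤
  | eq0 i => f0 i
  | eq1 i => f1 i
  | inf φ ψ => φ.eval f0 f1 ⊓ ψ.eval f0 f1
  | sup φ ψ => φ.eval f0 f1 ⊔ ψ.eval f0 f1

theorem FaceExpr.eval_rel {m : ℕ} {L : Type} [DistribLattice L] [BoundedOrder L]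
    (f0 f1 : Fin m → L) (hf : ∀ i, f0 i ⊓ f1 i = ⊥) {a b : FaceExpr m} (h : Rel a b) :
    a.eval f0 f1 = b.eval f0 f1 := by
  induction h with
  | refl => rfl
  | symm _ ih => exact ih.symm
  | trans _ _ ih ih' => exact ih.trans ih'
  | inf _ _ ih ih' => simp only [eval, ih, ih']
  | sup _ _ ih ih' => simp only [eval, ih, ih']
  | inf_comm => exact _root_.inf_comm _ _
  | sup_comm => exact _root_.sup_comm _ _
  | inf_assoc => exact _root_.inf_assoc _ _ _
  | sup_assoc => exact _root_.sup_assoc _ _ _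
  | inf_sup_self => exact _root_.inf_sup_self
  | sup_inf_self => exact _root_.sup_inf_self
  | inf_sup_left => exact _root_.inf_sup_left _ _ _
  | bot_sup => exact bot_sup_eq _
  | top_inf => exact top_inf_eq _
  | eq0_inf_eq1 i => exact hf i

/-- The lattice map out of the face lattice given by the images of the generators. -/
def Face.lift {m : ℕ} {L : Type} [DistribLattice L] [BoundedOrder L] (f0 f1 : Fin m → L)
    (hf : ∀ i, f0 i ⊓ f1 i = ⊥) : Face m → L :=
  Quotient.lift (FaceExpr.eval f0 f1) fun _ _ h => FaceExpr.eval_rel f0 f1 hf h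

/-- The pair of faces `((r = 0), (r = 1))`. -/
def DimExpr.faces {m : ℕ} : DimExpr m → Face m × Face m
  | zero => (⊤, ⊥)
  | one => (⊥, ⊤)
  | var i => (Face.eq0 i, Face.eq1 i)
  | neg r => (r.faces.2, r.faces.1)
  | inf r s => (r.faces.1 ⊔ s.faces.1, r.faces.2 ⊓ s.faces.2)
  | sup r s => (r.faces.1 ⊓ s.faces.1, r.faces.2 ⊔ s.faces.2)

theorem DimExpr.faces_rel {m : ℕ} {a b : DimExpr m} (h : Rel a b) : a.faces = b.faces := by
  induction h with
  | refl => rfl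
  | symm _ ih => exact ih.symm
  | trans _ _ ih ih' => exact ih.trans ih'
  | neg _ ih => simp only [faces, ih]
  | inf _ _ ih ih' => simp only [faces, ih, ih']
  | sup _ _ ih ih' => simp only [faces, ih, ih']
  | inf_comm => exact Prod.ext (_root_.sup_comm _ _) (_root_.inf_comm _ _)
  | sup_comm => exact Prod.ext (_root_.inf_comm _ _) (_root_.sup_comm _ _)
  | inf_assoc => exact Prod.ext (_root_.sup_assoc _ _ _) (_root_.inf_assoc _ _ _)
  | sup_assoc => exact Prod.ext (_root_.inf_assoc _ _ _) (_root_.sup_assoc _ _ _)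
  | inf_sup_self => exact Prod.ext _root_.sup_inf_self _root_.inf_sup_self
  | sup_inf_self => exact Prod.ext _root_.inf_sup_self _root_.sup_inf_self
  | inf_sup_left => exact Prod.ext (_root_.sup_inf_left _ _ _) (_root_.inf_sup_left _ _ _)
  | zero_sup => exact Prod.ext (top_inf_eq _) (bot_sup_eq _)
  | one_inf => exact Prod.ext (bot_sup_eq _) (top_inf_eq _)
  | neg_neg => rfl
  | neg_zero => rfl
  | neg_one => rfl
  | neg_sup => rfl
  | neg_inf => rfl

/-- The face `(r = 0)`. -/
def Dim.isZero {m : ℕ} (r : Dim m) : Face m :=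
  (Quotient.lift DimExpr.faces (fun _ _ h => DimExpr.faces_rel h) r).1

/-- The face `(r = 1)`. -/
def Dim.isOne {m : ℕ} (r : Dim m) : Face m :=
  (Quotient.lift DimExpr.faces (fun _ _ h => DimExpr.faces_rel h) r).2

theorem DimExpr.faces_disjoint {m : ℕ} (a : DimExpr m) : a.faces.1 ⊓ a.faces.2 = ⊥ := by
  induction a with
  | zero => exact inf_bot_eq _
  | one => exact bot_inf_eq _
  | var i => exact Face.eq0_inf_eq1 i
  | neg r ih => exact (inf_comm _ _).trans ih
  | inf r s ih ih' =>
    change (r.faces.1 ⊔ s.faces.1) ⊓ (r.faces.2 ⊓ s.faces.2) = ⊥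
    rw [_root_.inf_sup_right, ← _root_.inf_assoc, ih, inf_left_comm, ih', bot_inf_eq, inf_bot_eq,
      bot_sup_eq]
  | sup r s ih ih' =>
    change r.faces.1 ⊓ s.faces.1 ⊓ (r.faces.2 ⊔ s.faces.2) = ⊥
    rw [_root_.inf_sup_left, inf_right_comm, ih, _root_.inf_assoc, ih', bot_inf_eq, inf_bot_eq,
      bot_sup_eq]

theorem Dim.isZero_inf_isOne {m : ℕ} (r : Dim m) : r.isZero ⊓ r.isOne = ⊥ := by
  rcases r with ⟨a⟩; exact DimExpr.faces_disjoint a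

namespace Face

variable {m m' : ℕ}

/-- Substitution: `(i = b)` is sent to `(ρ i = b)`. -/
def subst (ρ : Fin m → Dim m') : Face m → Face m' :=
  lift (fun i => (ρ i).isZero) (fun i => (ρ i).isOne) fun i => (ρ i).isZero_inf_isOne

/-- Weakening by a new name `0`. -/
def wk (φ : Face m) : Face (m + 1) := φ.subst fun i => .var i.succ

/-- Instantiation of the last name by `r`. -/
def dinst (φ : Face (m + 1)) (r : Dim m) : Face m := φ.subst (Matrix.vecCons r Dim.var)

/-- `∀ i. φ`, where `i` is the last name: the lattice map that sends `(i = 0)` and `(i = 1)` to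
`0` and fixes the other generators. -/
def all : Face (m + 1) → Face m :=
  lift (Matrix.vecCons ⊥ eq0) (Matrix.vecCons ⊥ eq1) fun i => by
    refine Fin.cases ?_ (fun j => ?_) i
    · exact bot_inf_eq _
    · exact eq0_inf_eq1 j

end Face

/-- `EqMod ψ r s` means `r = s mod ψ`: the least family of congruences of de Morgan algebras,
indexed by `ψ : 𝔽`, in which `i` and `b` are identified when `ψ ≤ (i = b)`, and in which the
congruence of a (finite, possibly empty) join is the meet of the congruences. -/
inductive Dim.EqMod {m : ℕ} : Face m → Dim m → Dim m → Prop
  | refl {ψ} (r) : EqMod ψ r r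
  | symm {ψ r s} : EqMod ψ r s → EqMod ψ s r
  | trans {ψ r s t} : EqMod ψ r s → EqMod ψ s t → EqMod ψ r t
  | neg {ψ r s} : EqMod ψ r s → EqMod ψ r.neg s.neg
  | inf {ψ r r' s s'} : EqMod ψ r r' → EqMod ψ s s' → EqMod ψ (r ⊓ s) (r' ⊓ s')
  | sup {ψ r r' s s'} : EqMod ψ r r' → EqMod ψ s s' → EqMod ψ (r ⊔ s) (r' ⊔ s')
  | eq0 {ψ} (i) : ψ ≤ Face.eq0 i → EqMod ψ (.var i) ⊥
  | eq1 {ψ} (i) : ψ ≤ Face.eq1 i → EqMod ψ (.var i) ⊤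
  | empty (r s) : EqMod ⊥ r s
  | cover {ψ φ₁ φ₂ r s} : ψ ≤ φ₁ ⊔ φ₂ → EqMod φ₁ r s → EqMod φ₂ r s → EqMod ψ r s

/-! ### Raw syntax -/

/-- Terms and types.  `B` in `pi A B` and `sigma A B` and `t` in `lam A t` bind a term variable;
`t` in `plam t`, and `A` and `u` in `comp A φ u a` bind a name.
`sys k φ t` is the system `[φ₁ t₁, …, φₖ tₖ]`, `Glue φ T e A` is `Glue [φ ↦ (T, e)] A`,
`glue φ t a` is `glue [φ ↦ t] a`, and `unglue φ e b` is `unglue [φ ↦ e] b`. -/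
inductive Tm : ℕ → ℕ → Type
  | var {n m} : Fin n → Tm n m
  | pi {n m} : Tm n m → Tm (n + 1) m → Tm n m
  | lam {n m} : Tm n m → Tm (n + 1) m → Tm n m
  | app {n m} : Tm n m → Tm n m → Tm n m
  | sigma {n m} : Tm n m → Tm (n + 1) m → Tm n m
  | pair {n m} : Tm n m → Tm n m → Tm n m
  | fst {n m} : Tm n m → Tm n m
  | snd {n m} : Tm n m → Tm n m
  | nat {n m} : Tm n m
  | zero {n m} : Tm n m
  | suc {n m} : Tm n m → Tm n m
  | natrec {n m} : Tm n m → Tm n m → Tm n m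
  | path {n m} : Tm n m → Tm n m → Tm n m → Tm n m
  | plam {n m} : Tm n (m + 1) → Tm n m
  | papp {n m} : Tm n m → Dim m → Tm n m
  | sys {n m} (k : ℕ) : (Fin k → Face m) → (Fin k → Tm n m) → Tm n m
  | comp {n m} : Tm n (m + 1) → Face m → Tm n (m + 1) → Tm n m → Tm n m
  | Glue {n m} : Face m → Tm n m → Tm n m → Tm n m → Tm n m
  | glue {n m} : Face m → Tm n m → Tm n m → Tm n m
  | unglue {n m} : Face m → Tm n m → Tm n m → Tm n m
  | univ {n m} : Tm n m

/-- Lifting of a renaming of term variables under a binder. -/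
def liftVar {n n' : ℕ} (ξ : Fin n → Fin n') : Fin (n + 1) → Fin (n' + 1) :=
  Matrix.vecCons 0 fun i => (ξ i).succ

/-- Lifting of a substitution for names under a binder. -/
def liftDim {m m' : ℕ} (ρ : Fin m → Dim m') : Fin (m + 1) → Dim (m' + 1) :=
  Matrix.vecCons (.var 0) fun i => (ρ i).wk

namespace Tm

/-- Renaming of term variables and substitution for names. -/
def ren {n n' m m' : ℕ} (ξ : Fin n → Fin n') (ρ : Fin m → Dim m') : Tm n m → Tm n' m'
  | var i => var (ξ i)
  | pi A B => pi (A.ren ξ ρ) (B.ren (liftVar ξ) ρ)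
  | lam A t => lam (A.ren ξ ρ) (t.ren (liftVar ξ) ρ)
  | app t u => app (t.ren ξ ρ) (u.ren ξ ρ)
  | sigma A B => sigma (A.ren ξ ρ) (B.ren (liftVar ξ) ρ)
  | pair t u => pair (t.ren ξ ρ) (u.ren ξ ρ)
  | fst t => fst (t.ren ξ ρ)
  | snd t => snd (t.ren ξ ρ)
  | nat => nat
  | zero => zero
  | suc t => suc (t.ren ξ ρ)
  | natrec a b => natrec (a.ren ξ ρ) (b.ren ξ ρ)
  | path A t u => path (A.ren ξ ρ) (t.ren ξ ρ) (u.ren ξ ρ)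
  | plam t => plam (t.ren ξ (liftDim ρ))
  | papp t r => papp (t.ren ξ ρ) (r.subst ρ)
  | sys k φ t => sys k (fun l => (φ l).subst ρ) (fun l => (t l).ren ξ ρ)
  | comp A φ u a => comp (A.ren ξ (liftDim ρ)) (φ.subst ρ) (u.ren ξ (liftDim ρ)) (a.ren ξ ρ)
  | Glue φ T e A => Glue (φ.subst ρ) (T.ren ξ ρ) (e.ren ξ ρ) (A.ren ξ ρ)
  | glue φ t a => glue (φ.subst ρ) (t.ren ξ ρ) (a.ren ξ ρ)
  | unglue φ e b => unglue (φ.subst ρ) (e.ren ξ ρ) (b.ren ξ ρ)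
  | univ => univ

/-- Weakening by a new term variable. -/
def wk {n m : ℕ} (t : Tm n m) : Tm (n + 1) m := t.ren Fin.succ Dim.var

/-- Substitution for names only. -/
def dsubst {n m m' : ℕ} (t : Tm n m) (ρ : Fin m → Dim m') : Tm n m' := t.ren id ρ

/-- Weakening by a new name. -/
def wkD {n m : ℕ} (t : Tm n m) : Tm n (m + 1) := t.dsubst fun i => .var i.succ

/-- Simultaneous substitution for term variables and names. -/
def subst {n n' m m' : ℕ} (σ : Fin n → Tm n' m') (ρ : Fin m → Dim m') : Tm n m → Tm n' m'
  | var i => σ i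
  | pi A B => pi (A.subst σ ρ) (B.subst (Matrix.vecCons (var 0) fun i => (σ i).wk) ρ)
  | lam A t => lam (A.subst σ ρ) (t.subst (Matrix.vecCons (var 0) fun i => (σ i).wk) ρ)
  | app t u => app (t.subst σ ρ) (u.subst σ ρ)
  | sigma A B => sigma (A.subst σ ρ) (B.subst (Matrix.vecCons (var 0) fun i => (σ i).wk) ρ)
  | pair t u => pair (t.subst σ ρ) (u.subst σ ρ)
  | fst t => fst (t.subst σ ρ)
  | snd t => snd (t.subst σ ρ)
  | nat => nat
  | zero => zero
  | suc t => suc (t.subst σ ρ)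
  | natrec a b => natrec (a.subst σ ρ) (b.subst σ ρ)
  | path A t u => path (A.subst σ ρ) (t.subst σ ρ) (u.subst σ ρ)
  | plam t => plam (t.subst (fun i => (σ i).wkD) (liftDim ρ))
  | papp t r => papp (t.subst σ ρ) (r.subst ρ)
  | sys k φ t => sys k (fun l => (φ l).subst ρ) (fun l => (t l).subst σ ρ)
  | comp A φ u a =>
    comp (A.subst (fun i => (σ i).wkD) (liftDim ρ)) (φ.subst ρ)
      (u.subst (fun i => (σ i).wkD) (liftDim ρ)) (a.subst σ ρ)
  | Glue φ T e A => Glue (φ.subst ρ) (T.subst σ ρ) (e.subst σ ρ) (A.subst σ ρ)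
  | glue φ t a => glue (φ.subst ρ) (t.subst σ ρ) (a.subst σ ρ)
  | unglue φ e b => unglue (φ.subst ρ) (e.subst σ ρ) (b.subst σ ρ)
  | univ => univ

variable {n m : ℕ}

/-- `B (x / u)` for the last term variable `x`. -/
def inst (B : Tm (n + 1) m) (u : Tm n m) : Tm n m := B.subst (Matrix.vecCons u var) Dim.var

/-- `t (i / r)` for the last name `i`. -/
def dinst (t : Tm n (m + 1)) (r : Dim m) : Tm n m := t.dsubst (Matrix.vecCons r Dim.var)

/-- `t (i / 1 - i)` for the last name `i`. -/
def inv (t : Tm n (m + 1)) : Tm n (m + 1) :=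
  t.dsubst (Matrix.vecCons (Dim.var 0).neg fun l => .var l.succ)

/-- `t (i / i ∧ j)` for the last name `i` and a new name `j`, from `Γ, i` to `Γ, i, j`. -/
def conn (t : Tm n (m + 1)) : Tm n (m + 2) :=
  t.dsubst (Matrix.vecCons (Dim.var 1 ⊓ Dim.var 0) fun l => .var l.succ.succ)

/-- Weakening by a name declared just before the last one: from `Γ, i` to `Γ, j, i`. -/
def wkD₁ (t : Tm n (m + 1)) : Tm n (m + 2) := t.dsubst (liftDim fun l => .var l.succ)

/-- Weakening by a name declared before the last two: from `Γ, j, i` to `Γ, k, j, i`. -/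
def wkD₂ (t : Tm n (m + 2)) : Tm n (m + 3) := t.dsubst (liftDim (liftDim fun l => .var l.succ))

/-! ### Derived notions -/

def arrow (A B : Tm n m) : Tm n m := pi A B.wk

/-- `isContr A = (x : A) × ((y : A) → Path A x y)`. -/
def isContr (A : Tm n m) : Tm n m :=
  sigma A (pi A.wk (path A.wk.wk (var 1) (var 0)))

/-- `(x : T) × Path A y (f x)`. -/
def fiber (T A f y : Tm n m) : Tm n m :=
  sigma T (path A.wk y.wk (app f.wk (var 0)))

/-- `isEquiv T A f = (y : A) → isContr ((x : T) × Path A y (f x))`. -/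
def isEquiv (T A f : Tm n m) : Tm n m :=
  pi A (isContr (fiber T.wk A.wk f.wk (var 0)))

/-- `Equiv T A = (f : T → A) × isEquiv T A f`. -/
def equiv (T A : Tm n m) : Tm n m :=
  sigma (arrow T A) (isEquiv T.wk A.wk (var 0))

/-- `compⁱ A [φ₁ ↦ u₁, …, φₖ ↦ uₖ] a`. -/
def compSys {k : ℕ} (A : Tm n (m + 1)) (φ : Fin k → Face m) (u : Fin k → Tm n (m + 1))
    (a : Tm n m) : Tm n m :=
  comp A (Finset.univ.sup φ) (sys k (fun l => (φ l).wk) u) a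

/-- `fillⁱ A [φ ↦ u] a = compʲ A(i/i∧j) [φ ↦ u(i/i∧j), (i = 0) ↦ a] a`, in context `Γ, i`. -/
def fill (A : Tm n (m + 1)) (φ : Face m) (u : Tm n (m + 1)) (a : Tm n m) : Tm n (m + 1) :=
  compSys A.conn ![φ.wk, Face.eq0 0] ![u.conn, a.wkD.wkD] a.wkD

/-- `fillⁱ A [φ₁ ↦ u₁, …, φₖ ↦ uₖ] a`, in context `Γ, i`. -/
def fillSys {k : ℕ} (A : Tm n (m + 1)) (φ : Fin k → Face m) (u : Fin k → Tm n (m + 1))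
    (a : Tm n m) : Tm n (m + 1) :=
  fill A (Finset.univ.sup φ) (sys k (fun l => (φ l).wk) u) a

/-- `transportⁱ A a = compⁱ A [] a`. -/
def transport (A : Tm n (m + 1)) (a : Tm n m) : Tm n m := compSys A ![] ![] a

/-- `(fillⁱ A(i/1-i) [] y)(i/1-i)`, for `y : A(i1)`, in context `Γ, i`. -/
def fillInv (A : Tm n (m + 1)) (y : Tm n m) : Tm n (m + 1) := (fillSys A.inv ![] ![] y).inv

/-- `contr p [φ ↦ u] = compⁱ A [φ ↦ p.2 u i] p.1`, for `p : isContr A`. -/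
def contr (A p : Tm n m) (φ : Face m) (u : Tm n m) : Tm n m :=
  comp A.wkD φ (papp (app (snd p).wkD u.wkD) (.var 0)) (fst p)

/-- `presⁱ f [φ ↦ t] t₀ = ⟨j⟩ compⁱ A [φ ∨ (j = 1) ↦ f v] (f(i0) t₀)` with
`v = fillⁱ T [φ ↦ t] t₀`, for `f : T → A` in context `Γ, i`. -/
def pres (T A f : Tm n (m + 1)) (φ : Face m) (t : Tm n (m + 1)) (t₀ : Tm n m) : Tm n m :=
  plam (comp A.wkD₁ (φ.wk ⊔ Face.eq1 0) (app f (fill T φ t t₀)).wkD₁ (app (f.dinst ⊥) t₀).wkD)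

/-- `equiv e [φ ↦ w] a = contr (e.2 a) [φ ↦ w]`, for `e : Equiv T A`. -/
def equivOp (T A e : Tm n m) (φ : Face m) (w a : Tm n m) : Tm n m :=
  contr (fiber T A (fst e) a) (app (snd e) a) φ w

/-- The right-hand side of the equation for `compⁱ (Glue [φ ↦ (T, e)] A) [ψ ↦ b] b₀`. -/
def compGlue (φ : Face (m + 1)) (T e A : Tm n (m + 1)) (ψ : Face m) (b : Tm n (m + 1))
    (b₀ : Tm n m) : Tm n m :=
  let a := unglue φ e b
  let a₀ := unglue (φ.dinst ⊥) (e.dinst ⊥) b₀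
  let δ := φ.all
  let a₁' := comp A ψ a a₀
  let t₁' := comp T ψ b b₀
  let ω := pres T A (fst e) ψ b b₀
  let w := equivOp (T.dinst ⊤) (A.dinst ⊤) (e.dinst ⊤) (Finset.univ.sup ![δ, ψ])
    (sys 2 ![δ, ψ] ![pair t₁' ω, pair (b.dinst ⊤) (plam a₁'.wkD)]) a₁'
  let t₁ := fst w
  let α := snd w
  let a₁ := compSys (A.dinst ⊤).wkD ![φ.dinst ⊤, ψ]
    ![papp α.wkD (.var 0), (a.dinst ⊤).wkD] a₁'
  glue (φ.dinst ⊤) t₁ a₁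

/-! The equivalence between the end points of a line `E` of types, in context `Γ, i`:
`lineG E y` is `g y : E(i0)`, and in context `Γ, i` we have `lineU E x` and `lineV E y`, which are
`u x` and `v y`; `lineTheta₀` and `lineTheta₁` live in `Γ, j, i`, `lineOmega` lives in `Γ, j`, and
`lineDelta` lives in `Γ, k, j`. -/

def lineG (E : Tm n (m + 1)) (y : Tm n m) : Tm n m := transport E.inv y

def lineU (E : Tm n (m + 1)) (x : Tm n m) : Tm n (m + 1) := fillSys E ![] ![] x

def lineV (E : Tm n (m + 1)) (y : Tm n m) : Tm n (m + 1) := fillInv E y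

/-- `fillⁱ E [(j = 0) ↦ v y, (j = 1) ↦ u (g y)] (g y)`. -/
def lineTheta₀ (E : Tm n (m + 1)) (y : Tm n m) : Tm n (m + 2) :=
  fillSys E.wkD₁ ![Face.eq0 0, Face.eq1 0]
    ![(lineV E y).wkD₁, (lineU E (lineG E y)).wkD₁] (lineG E y).wkD

/-- `(fillⁱ E(i/1-i) [(j = 0) ↦ (v y)(i/1-i), (j = 1) ↦ (u x)(i/1-i)] (β j))(i/1-i)`. -/
def lineTheta₁ (E : Tm n (m + 1)) (y x β : Tm n m) : Tm n (m + 2) :=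
  (fillSys E.wkD₁.inv ![Face.eq0 0, Face.eq1 0]
    ![(lineV E y).wkD₁.inv, (lineU E x).wkD₁.inv] (papp β.wkD (.var 0))).inv

/-- `ω = θ₁(i0)`. -/
def lineOmega (E : Tm n (m + 1)) (y x β : Tm n m) : Tm n (m + 1) :=
  (lineTheta₁ E y x β).dinst ⊥

/-- `compⁱ E [(k = 0) ↦ θ₀, (k = 1) ↦ θ₁, (j = 0) ↦ v y, (j = 1) ↦ u ω(j/k)] ω(j/j∧k)`. -/
def lineDelta (E : Tm n (m + 1)) (y x β : Tm n m) : Tm n (m + 2) :=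
  compSys E.wkD₁.wkD₁ ![Face.eq0 1, Face.eq1 1, Face.eq0 0, Face.eq1 0]
    ![(lineTheta₀ E y).wkD₂, (lineTheta₁ E y x β).wkD₂, (lineV E y).wkD₁.wkD₁,
      (lineU E.wkD₁ (lineOmega E y x β)).wkD₁]
    (lineOmega E y x β).conn

/-- `f = λ x : E(i0). transportⁱ E x`. -/
def lineF (E : Tm n (m + 1)) : Tm n m := lam (E.dinst ⊥) (transport E.wk (var 0))

/-- `equivⁱ E : Equiv E(i0) E(i1)`. -/
def equivLine (E : Tm n (m + 1)) : Tm n m :=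
  pair (lineF E)
    (lam (E.dinst ⊤)
      (pair (pair (lineG E.wk (var 0)) (plam ((lineTheta₀ E.wk (var 0)).dinst ⊤)))
        (lam (fiber (E.dinst ⊥).wk (E.dinst ⊤).wk (lineF E).wk (var 0))
          (plam (pair (lineOmega E.wk.wk (var 1) (fst (var 0)) (snd (var 0)))
            (plam (lineDelta E.wk.wk (var 1) (fst (var 0)) (snd (var 0)))))))))

end Tm

/-! ### Contexts -/

/-- Contexts: `Γ, x : A`, `Γ, i : 𝕀` and restrictions `Γ, φ`. -/
inductive Ctx : ℕ → ℕ → Type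
  | nil : Ctx 0 0
  | tm {n m} : Ctx n m → Tm n m → Ctx (n + 1) m
  | dim {n m} : Ctx n m → Ctx n (m + 1)
  | face {n m} : Ctx n m → Face m → Ctx n m

namespace Ctx

/-- The type of a variable, as a type in the whole context. -/
def lookup {n m : ℕ} : Ctx n m → Fin n → Tm n m
  | nil, x => x.elim0
  | tm Γ A, x => Fin.cases A.wk (fun y => (Γ.lookup y).wk) x
  | dim Γ, x => (Γ.lookup x).wkD
  | face Γ _, x => Γ.lookup x

/-- The conjunction of all restrictions in a context. -/
def restr {n m : ℕ} : Ctx n m → Face m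
  | nil => ⊤
  | tm Γ _ => Γ.restr
  | dim Γ => Γ.restr.wk
  | face Γ φ => Γ.restr ⊓ φ

/-- `Γ ⊢ r = s : 𝕀`, for a well-formed `Γ`. -/
def DimEq {n m : ℕ} (Γ : Ctx n m) (r s : Dim m) : Prop := Dim.EqMod Γ.restr r s

/-- `Γ ⊢ φ = ψ : 𝔽`, for a well-formed `Γ`. -/
def FaceEq {n m : ℕ} (Γ : Ctx n m) (φ ψ : Face m) : Prop := Γ.restr ⊓ φ = Γ.restr ⊓ ψ

end Ctx

/-! ### Judgments and derivations -/

/-- The forms of judgment `Γ ⊢`, `Γ ⊢ A`, `Γ ⊢ A = B`, `Γ ⊢ t : A` and `Γ ⊢ t = u : A`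
(without `Γ`). -/
inductive Judgment (n m : ℕ) : Type
  | ctx : Judgment n m
  | ty : Tm n m → Judgment n m
  | tyEq : Tm n m → Tm n m → Judgment n m
  | tm : Tm n m → Tm n m → Judgment n m
  | tmEq : Tm n m → Tm n m → Tm n m → Judgment n m

open Tm Judgment

/-- Derivability of `Γ ⊢ J`.  The judgments `Γ ⊢ r : 𝕀` and `Γ ⊢ φ : 𝔽` amount to `Γ ⊢`, since
the syntax is well scoped. -/
inductive Der : {n m : ℕ} → Ctx n m → Judgment n m → Prop
  -- contexts
  | ctx_nil : Der .nil ctx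
  | ctx_tm {n m} {Γ : Ctx n m} {A} : Der Γ (ty A) → Der (Γ.tm A) ctx
  | ctx_dim {n m} {Γ : Ctx n m} : Der Γ ctx → Der Γ.dim ctx
  | ctx_face {n m} {Γ : Ctx n m} {φ} : Der Γ ctx → Der (Γ.face φ) ctx
  -- equivalence and conversion
  | ty_refl {n m} {Γ : Ctx n m} {A} : Der Γ (ty A) → Der Γ (tyEq A A)
  | ty_symm {n m} {Γ : Ctx n m} {A B} : Der Γ (tyEq A B) → Der Γ (tyEq B A)
  | ty_trans {n m} {Γ : Ctx n m} {A B C} :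
      Der Γ (tyEq A B) → Der Γ (tyEq B C) → Der Γ (tyEq A C)
  | tm_refl {n m} {Γ : Ctx n m} {t A} : Der Γ (tm t A) → Der Γ (tmEq t t A)
  | tm_symm {n m} {Γ : Ctx n m} {t u A} : Der Γ (tmEq t u A) → Der Γ (tmEq u t A)
  | tm_trans {n m} {Γ : Ctx n m} {t u v A} :
      Der Γ (tmEq t u A) → Der Γ (tmEq u v A) → Der Γ (tmEq t v A)
  | tm_conv {n m} {Γ : Ctx n m} {t A B} : Der Γ (tm t A) → Der Γ (tyEq A B) → Der Γ (tm t B)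
  | tmEq_conv {n m} {Γ : Ctx n m} {t u A B} :
      Der Γ (tmEq t u A) → Der Γ (tyEq A B) → Der Γ (tmEq t u B)
  -- variables
  | var {n m} {Γ : Ctx n m} (x : Fin n) : Der Γ ctx → Der Γ (tm (.var x) (Γ.lookup x))
  -- dependent functions
  | pi {n m} {Γ : Ctx n m} {A B} : Der Γ (ty A) → Der (Γ.tm A) (ty B) → Der Γ (ty (.pi A B))
  | pi_congr {n m} {Γ : Ctx n m} {A A' B B'} :
      Der Γ (tyEq A A') → Der (Γ.tm A) (tyEq B B') → Der Γ (tyEq (.pi A B) (.pi A' B'))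
  | lam {n m} {Γ : Ctx n m} {A B t} : Der Γ (ty A) → Der (Γ.tm A) (tm t B) →
      Der Γ (tm (.lam A t) (.pi A B))
  | lam_congr {n m} {Γ : Ctx n m} {A A' B t t'} :
      Der Γ (tyEq A A') → Der (Γ.tm A) (tmEq t t' B) →
      Der Γ (tmEq (.lam A t) (.lam A' t') (.pi A B))
  | app {n m} {Γ : Ctx n m} {A B t u} :
      Der Γ (tm t (.pi A B)) → Der Γ (tm u A) → Der Γ (tm (.app t u) (B.inst u))
  | app_congr {n m} {Γ : Ctx n m} {A B t t' u u'} :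
      Der Γ (tmEq t t' (.pi A B)) → Der Γ (tmEq u u' A) →
      Der Γ (tmEq (.app t u) (.app t' u') (B.inst u))
  | pi_beta {n m} {Γ : Ctx n m} {A B t u} :
      Der (Γ.tm A) (tm t B) → Der Γ (tm u A) →
      Der Γ (tmEq (.app (.lam A t) u) (t.inst u) (B.inst u))
  | pi_eta {n m} {Γ : Ctx n m} {A B t u} :
      Der Γ (tm t (.pi A B)) → Der Γ (tm u (.pi A B)) →
      Der (Γ.tm A) (tmEq (.app t.wk (.var 0)) (.app u.wk (.var 0)) B) →
      Der Γ (tmEq t u (.pi A B))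
  -- dependent pairs
  | sigma {n m} {Γ : Ctx n m} {A B} :
      Der Γ (ty A) → Der (Γ.tm A) (ty B) → Der Γ (ty (.sigma A B))
  | sigma_congr {n m} {Γ : Ctx n m} {A A' B B'} :
      Der Γ (tyEq A A') → Der (Γ.tm A) (tyEq B B') → Der Γ (tyEq (.sigma A B) (.sigma A' B'))
  | pair {n m} {Γ : Ctx n m} {A B t u} :
      Der (Γ.tm A) (ty B) → Der Γ (tm t A) → Der Γ (tm u (B.inst t)) →
      Der Γ (tm (.pair t u) (.sigma A B))
  | pair_congr {n m} {Γ : Ctx n m} {A B t t' u u'} :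
      Der (Γ.tm A) (ty B) → Der Γ (tmEq t t' A) → Der Γ (tmEq u u' (B.inst t)) →
      Der Γ (tmEq (.pair t u) (.pair t' u') (.sigma A B))
  | fst {n m} {Γ : Ctx n m} {A B t} : Der Γ (tm t (.sigma A B)) → Der Γ (tm (.fst t) A)
  | fst_congr {n m} {Γ : Ctx n m} {A B t t'} :
      Der Γ (tmEq t t' (.sigma A B)) → Der Γ (tmEq (.fst t) (.fst t') A)
  | snd {n m} {Γ : Ctx n m} {A B t} :
      Der Γ (tm t (.sigma A B)) → Der Γ (tm (.snd t) (B.inst (.fst t)))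
  | snd_congr {n m} {Γ : Ctx n m} {A B t t'} :
      Der Γ (tmEq t t' (.sigma A B)) → Der Γ (tmEq (.snd t) (.snd t') (B.inst (.fst t)))
  | fst_beta {n m} {Γ : Ctx n m} {A B t u} :
      Der (Γ.tm A) (ty B) → Der Γ (tm t A) → Der Γ (tm u (B.inst t)) →
      Der Γ (tmEq (.fst (.pair t u)) t A)
  | snd_beta {n m} {Γ : Ctx n m} {A B t u} :
      Der (Γ.tm A) (ty B) → Der Γ (tm t A) → Der Γ (tm u (B.inst t)) →
      Der Γ (tmEq (.snd (.pair t u)) u (B.inst t))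
  | sigma_eta {n m} {Γ : Ctx n m} {A B t u} :
      Der Γ (tm t (.sigma A B)) → Der Γ (tm u (.sigma A B)) →
      Der (Γ.tm A) (ty B) → Der Γ (tmEq (.fst t) (.fst u) A) →
      Der Γ (tmEq (.snd t) (.snd u) (B.inst (.fst t))) → Der Γ (tmEq t u (.sigma A B))
  -- natural numbers
  | nat {n m} {Γ : Ctx n m} : Der Γ ctx → Der Γ (ty .nat)
  | zero {n m} {Γ : Ctx n m} : Der Γ ctx → Der Γ (tm .zero .nat)
  | suc {n m} {Γ : Ctx n m} {t} : Der Γ (tm t .nat) → Der Γ (tm (.suc t) .nat)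
  | suc_congr {n m} {Γ : Ctx n m} {t t'} :
      Der Γ (tmEq t t' .nat) → Der Γ (tmEq (.suc t) (.suc t') .nat)
  | natrec {n m} {Γ : Ctx n m} {P a b} :
      Der (Γ.tm .nat) (ty P) → Der Γ (tm a (P.inst .zero)) →
      Der Γ (tm b (.pi .nat
        (arrow P (P.subst (Matrix.vecCons (.suc (.var 0)) fun x => .var x.succ) Dim.var)))) →
      Der Γ (tm (.natrec a b) (.pi .nat P))
  | natrec_congr {n m} {Γ : Ctx n m} {P a a' b b'} :
      Der (Γ.tm .nat) (ty P) → Der Γ (tmEq a a' (P.inst .zero)) →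
      Der Γ (tmEq b b' (.pi .nat
        (arrow P (P.subst (Matrix.vecCons (.suc (.var 0)) fun x => .var x.succ) Dim.var)))) →
      Der Γ (tmEq (.natrec a b) (.natrec a' b') (.pi .nat P))
  | natrec_zero {n m} {Γ : Ctx n m} {P a b} :
      Der (Γ.tm .nat) (ty P) → Der Γ (tm a (P.inst .zero)) →
      Der Γ (tm b (.pi .nat
        (arrow P (P.subst (Matrix.vecCons (.suc (.var 0)) fun x => .var x.succ) Dim.var)))) →
      Der Γ (tmEq (.app (.natrec a b) .zero) a (P.inst .zero))
  | natrec_suc {n m} {Γ : Ctx n m} {P a b t} :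
      Der (Γ.tm .nat) (ty P) → Der Γ (tm a (P.inst .zero)) →
      Der Γ (tm b (.pi .nat
        (arrow P (P.subst (Matrix.vecCons (.suc (.var 0)) fun x => .var x.succ) Dim.var)))) →
      Der Γ (tm t .nat) →
      Der Γ (tmEq (.app (.natrec a b) (.suc t)) (.app (.app b t) (.app (.natrec a b) t))
        (P.inst (.suc t)))
  -- path types
  | path {n m} {Γ : Ctx n m} {A t u} :
      Der Γ (ty A) → Der Γ (tm t A) → Der Γ (tm u A) → Der Γ (ty (.path A t u))
  | path_congr {n m} {Γ : Ctx n m} {A A' t t' u u'} :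
      Der Γ (tyEq A A') → Der Γ (tmEq t t' A) → Der Γ (tmEq u u' A) →
      Der Γ (tyEq (.path A t u) (.path A' t' u'))
  | plam {n m} {Γ : Ctx n m} {A t} :
      Der Γ (ty A) → Der Γ.dim (tm t A.wkD) →
      Der Γ (tm (.plam t) (.path A (t.dinst ⊥) (t.dinst ⊤)))
  | plam_congr {n m} {Γ : Ctx n m} {A t t'} :
      Der Γ (ty A) → Der Γ.dim (tmEq t t' A.wkD) →
      Der Γ (tmEq (.plam t) (.plam t') (.path A (t.dinst ⊥) (t.dinst ⊤)))
  | papp {n m} {Γ : Ctx n m} {A t u₀ u₁} (r) :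
      Der Γ (tm t (.path A u₀ u₁)) → Der Γ (tm (.papp t r) A)
  | papp_congr {n m} {Γ : Ctx n m} {A t t' u₀ u₁ r r'} :
      Der Γ (tmEq t t' (.path A u₀ u₁)) → Γ.DimEq r r' →
      Der Γ (tmEq (.papp t r) (.papp t' r') A)
  | path_beta {n m} {Γ : Ctx n m} {A t} (r) :
      Der Γ (ty A) → Der Γ.dim (tm t A.wkD) → Der Γ (tmEq (.papp (.plam t) r) (t.dinst r) A)
  | path_eta {n m} {Γ : Ctx n m} {A t u u₀ u₁} :
      Der Γ (tm t (.path A u₀ u₁)) → Der Γ (tm u (.path A u₀ u₁)) →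
      Der Γ.dim (tmEq (.papp t.wkD (.var 0)) (.papp u.wkD (.var 0)) A.wkD) →
      Der Γ (tmEq t u (.path A u₀ u₁))
  | papp_zero {n m} {Γ : Ctx n m} {A t u₀ u₁} :
      Der Γ (tm t (.path A u₀ u₁)) → Der Γ (tmEq (.papp t ⊥) u₀ A)
  | papp_one {n m} {Γ : Ctx n m} {A t u₀ u₁} :
      Der Γ (tm t (.path A u₀ u₁)) → Der Γ (tmEq (.papp t ⊤) u₁ A)
  -- systems
  | patch {n m} {Γ : Ctx n m} {J k} (φ : Fin k → Face m) :
      Der Γ ctx → Γ.FaceEq (Finset.univ.sup φ) ⊤ → (∀ l, Der (Γ.face (φ l)) J) → Der Γ J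
  | sysTy {n m} {Γ : Ctx n m} {k} {φ : Fin k → Face m} {A} :
      Der Γ ctx → Γ.FaceEq (Finset.univ.sup φ) ⊤ → (∀ l, Der (Γ.face (φ l)) (ty (A l))) →
      (∀ l l', Der (Γ.face (φ l ⊓ φ l')) (tyEq (A l) (A l'))) → Der Γ (ty (.sys k φ A))
  | sysTy_congr {n m} {Γ : Ctx n m} {k} {φ φ' : Fin k → Face m} {A A'} :
      Γ.FaceEq (Finset.univ.sup φ) ⊤ → Der Γ (ty (.sys k φ A)) → Der Γ (ty (.sys k φ' A')) →
      (∀ l, Γ.FaceEq (φ l) (φ' l)) → (∀ l, Der (Γ.face (φ l)) (tyEq (A l) (A' l))) →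
      Der Γ (tyEq (.sys k φ A) (.sys k φ' A'))
  | sysTy_eq {n m} {Γ : Ctx n m} {k} {φ : Fin k → Face m} {A} (l) :
      Γ.FaceEq (Finset.univ.sup φ) ⊤ → Der Γ (ty (.sys k φ A)) → Γ.FaceEq (φ l) ⊤ →
      Der Γ (tyEq (.sys k φ A) (A l))
  | sys {n m} {Γ : Ctx n m} {k} {φ : Fin k → Face m} {A t} :
      Der Γ (ty A) → Γ.FaceEq (Finset.univ.sup φ) ⊤ → (∀ l, Der (Γ.face (φ l)) (tm (t l) A)) →
      (∀ l l', Der (Γ.face (φ l ⊓ φ l')) (tmEq (t l) (t l') A)) → Der Γ (tm (.sys k φ t) A)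
  | sys_congr {n m} {Γ : Ctx n m} {k} {φ φ' : Fin k → Face m} {A t t'} :
      Γ.FaceEq (Finset.univ.sup φ) ⊤ → Der Γ (tm (.sys k φ t) A) → Der Γ (tm (.sys k φ' t') A) →
      (∀ l, Γ.FaceEq (φ l) (φ' l)) → (∀ l, Der (Γ.face (φ l)) (tmEq (t l) (t' l) A)) →
      Der Γ (tmEq (.sys k φ t) (.sys k φ' t') A)
  | sys_eq {n m} {Γ : Ctx n m} {k} {φ : Fin k → Face m} {A t} (l) :
      Γ.FaceEq (Finset.univ.sup φ) ⊤ → Der Γ (tm (.sys k φ t) A) → Γ.FaceEq (φ l) ⊤ →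
      Der Γ (tmEq (.sys k φ t) (t l) A)
  -- compositions
  | comp {n m} {Γ : Ctx n m} {φ A u a} :
      Der Γ.dim (ty A) → Der (Γ.face φ).dim (tm u A) → Der Γ (tm a (A.dinst ⊥)) →
      Der (Γ.face φ) (tmEq a (u.dinst ⊥) (A.dinst ⊥)) →
      Der Γ (tm (.comp A φ u a) (A.dinst ⊤))
  | comp_face {n m} {Γ : Ctx n m} {φ A u a} :
      Der Γ.dim (ty A) → Der (Γ.face φ).dim (tm u A) → Der Γ (tm a (A.dinst ⊥)) →
      Der (Γ.face φ) (tmEq a (u.dinst ⊥) (A.dinst ⊥)) →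
      Der (Γ.face φ) (tmEq (.comp A φ u a) (u.dinst ⊤) (A.dinst ⊤))
  | comp_congr {n m} {Γ : Ctx n m} {φ φ' A A' u u' a a'} :
      Γ.FaceEq φ φ' → Der Γ.dim (tyEq A A') → Der (Γ.face φ).dim (tmEq u u' A) →
      Der Γ (tmEq a a' (A.dinst ⊥)) → Der (Γ.face φ) (tmEq a (u.dinst ⊥) (A.dinst ⊥)) →
      Der Γ (tmEq (.comp A φ u a) (.comp A' φ' u' a') (A.dinst ⊤))
  | comp_pi {n m} {Γ : Ctx n m} {φ A B u a u₁} :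
      Der Γ.dim (ty A) → Der (Γ.dim.tm A) (ty B) → Der (Γ.face φ).dim (tm u (.pi A B)) →
      Der Γ (tm a ((Tm.pi A B).dinst ⊥)) →
      Der (Γ.face φ) (tmEq a (u.dinst ⊥) ((Tm.pi A B).dinst ⊥)) →
      Der Γ (tm u₁ (A.dinst ⊤)) →
      Der Γ (tmEq (.app (.comp (.pi A B) φ u a) u₁)
        (.comp (B.inst (fillInv A u₁)) φ (.app u (fillInv A u₁))
          (.app a ((fillInv A u₁).dinst ⊥)))
        ((B.inst (fillInv A u₁)).dinst ⊤))
  | comp_sigma {n m} {Γ : Ctx n m} {φ A B u a} :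
      Der Γ.dim (ty A) → Der (Γ.dim.tm A) (ty B) → Der (Γ.face φ).dim (tm u (.sigma A B)) →
      Der Γ (tm a ((Tm.sigma A B).dinst ⊥)) →
      Der (Γ.face φ) (tmEq a (u.dinst ⊥) ((Tm.sigma A B).dinst ⊥)) →
      Der Γ (tmEq (.comp (.sigma A B) φ u a)
        (.pair (.comp A φ (.fst u) (.fst a))
          (.comp (B.inst (fill A φ (.fst u) (.fst a))) φ (.snd u) (.snd a)))
        ((Tm.sigma A B).dinst ⊤))
  | comp_nat_zero {n m} {Γ : Ctx n m} {φ} :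
      Der Γ ctx → Der Γ (tmEq (.comp .nat φ .zero .zero) .zero .nat)
  | comp_nat_suc {n m} {Γ : Ctx n m} {φ t t₀} :
      Der (Γ.face φ).dim (tm t .nat) → Der Γ (tm t₀ .nat) →
      Der (Γ.face φ) (tmEq t₀ (t.dinst ⊥) .nat) →
      Der Γ (tmEq (.comp .nat φ (.suc t) (.suc t₀)) (.suc (.comp .nat φ t t₀)) .nat)
  | comp_path {n m} {Γ : Ctx n m} {φ A v₀ v₁ p p₀} :
      Der Γ.dim (ty A) → Der Γ.dim (tm v₀ A) → Der Γ.dim (tm v₁ A) →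
      Der (Γ.face φ).dim (tm p (.path A v₀ v₁)) →
      Der Γ (tm p₀ ((Tm.path A v₀ v₁).dinst ⊥)) →
      Der (Γ.face φ) (tmEq p₀ (p.dinst ⊥) ((Tm.path A v₀ v₁).dinst ⊥)) →
      Der Γ (tmEq (.comp (.path A v₀ v₁) φ p p₀)
        (.plam (compSys A.wkD₁ ![φ.wk, Face.eq0 0, Face.eq1 0]
          ![.papp p.wkD₁ (.var 1), v₀.wkD₁, v₁.wkD₁] (.papp p₀.wkD (.var 0))))
        ((Tm.path A v₀ v₁).dinst ⊤))
  -- glueing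
  | Glue {n m} {Γ : Ctx n m} {φ T e A} :
      Der Γ (ty A) → Der (Γ.face φ) (ty T) → Der (Γ.face φ) (tm e (equiv T A)) →
      Der Γ (ty (.Glue φ T e A))
  | Glue_congr {n m} {Γ : Ctx n m} {φ φ' T T' e e' A A'} :
      Γ.FaceEq φ φ' → Der Γ (tyEq A A') → Der (Γ.face φ) (tyEq T T') →
      Der (Γ.face φ) (tmEq e e' (equiv T A)) →
      Der Γ (tyEq (.Glue φ T e A) (.Glue φ' T' e' A'))
  | unglue {n m} {Γ : Ctx n m} {φ T e A b} :
      Der Γ (tm b (.Glue φ T e A)) → Der Γ (tm (.unglue φ e b) A)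
  | unglue_face {n m} {Γ : Ctx n m} {φ T e A b} :
      Der Γ (tm b (.Glue φ T e A)) →
      Der (Γ.face φ) (tmEq (.unglue φ e b) (.app (.fst e) b) A)
  | unglue_congr {n m} {Γ : Ctx n m} {φ φ' T e e' A b b'} :
      Γ.FaceEq φ φ' → Der (Γ.face φ) (tmEq e e' (equiv T A)) →
      Der Γ (tmEq b b' (.Glue φ T e A)) →
      Der Γ (tmEq (.unglue φ e b) (.unglue φ' e' b') A)
  | glue {n m} {Γ : Ctx n m} {φ T e A t a} :
      Der (Γ.face φ) (tm e (equiv T A)) → Der (Γ.face φ) (tm t T) → Der Γ (tm a A) →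
      Der (Γ.face φ) (tmEq a (.app (.fst e) t) A) →
      Der Γ (tm (.glue φ t a) (.Glue φ T e A))
  | glue_congr {n m} {Γ : Ctx n m} {φ φ' T e A t t' a a'} :
      Γ.FaceEq φ φ' → Der (Γ.face φ) (tm e (equiv T A)) → Der (Γ.face φ) (tmEq t t' T) →
      Der Γ (tmEq a a' A) → Der (Γ.face φ) (tmEq a (.app (.fst e) t) A) →
      Der Γ (tmEq (.glue φ t a) (.glue φ' t' a') (.Glue φ T e A))
  | Glue_top {n m} {Γ : Ctx n m} {T e A} :
      Der Γ (ty T) → Der Γ (tm e (equiv T A)) → Der Γ (tyEq (.Glue ⊤ T e A) T)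
  | glue_top {n m} {Γ : Ctx n m} {T e A t} :
      Der Γ (tm t T) → Der Γ (tm e (equiv T A)) →
      Der Γ (tmEq (.glue ⊤ t (.app (.fst e) t)) t T)
  | glue_eta {n m} {Γ : Ctx n m} {φ T e A b} :
      Der Γ (tm b (.Glue φ T e A)) →
      Der Γ (tmEq b (.glue φ b (.unglue φ e b)) (.Glue φ T e A))
  | glue_beta {n m} {Γ : Ctx n m} {φ T e A t a} :
      Der (Γ.face φ) (tm e (equiv T A)) → Der (Γ.face φ) (tm t T) → Der Γ (tm a A) →
      Der (Γ.face φ) (tmEq a (.app (.fst e) t) A) →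
      Der Γ (tmEq (.unglue φ e (.glue φ t a)) a A)
  | comp_Glue {n m} {Γ : Ctx n m} {φ T e A ψ b b₀} :
      Der Γ.dim (ty A) → Der (Γ.dim.face φ) (ty T) → Der (Γ.dim.face φ) (tm e (equiv T A)) →
      Der (Γ.face ψ).dim (tm b (.Glue φ T e A)) →
      Der Γ (tm b₀ ((Tm.Glue φ T e A).dinst ⊥)) →
      Der (Γ.face ψ) (tmEq b₀ (b.dinst ⊥) ((Tm.Glue φ T e A).dinst ⊥)) →
      Der Γ (tmEq (.comp (.Glue φ T e A) ψ b b₀) (compGlue φ T e A ψ b b₀)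
        ((Tm.Glue φ T e A).dinst ⊤))
  -- the universe
  | univ {n m} {Γ : Ctx n m} : Der Γ ctx → Der Γ (ty .univ)
  | el {n m} {Γ : Ctx n m} {A} : Der Γ (tm A .univ) → Der Γ (ty A)
  | el_congr {n m} {Γ : Ctx n m} {A B} : Der Γ (tmEq A B .univ) → Der Γ (tyEq A B)
  | univ_pi {n m} {Γ : Ctx n m} {A B} :
      Der Γ (tm A .univ) → Der (Γ.tm A) (tm B .univ) → Der Γ (tm (.pi A B) .univ)
  | univ_pi_congr {n m} {Γ : Ctx n m} {A A' B B'} :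
      Der Γ (tmEq A A' .univ) → Der (Γ.tm A) (tmEq B B' .univ) →
      Der Γ (tmEq (.pi A B) (.pi A' B') .univ)
  | univ_sigma {n m} {Γ : Ctx n m} {A B} :
      Der Γ (tm A .univ) → Der (Γ.tm A) (tm B .univ) → Der Γ (tm (.sigma A B) .univ)
  | univ_sigma_congr {n m} {Γ : Ctx n m} {A A' B B'} :
      Der Γ (tmEq A A' .univ) → Der (Γ.tm A) (tmEq B B' .univ) →
      Der Γ (tmEq (.sigma A B) (.sigma A' B') .univ)
  | univ_nat {n m} {Γ : Ctx n m} : Der Γ ctx → Der Γ (tm .nat .univ)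
  | univ_path {n m} {Γ : Ctx n m} {A t u} :
      Der Γ (tm A .univ) → Der Γ (tm t A) → Der Γ (tm u A) → Der Γ (tm (.path A t u) .univ)
  | univ_path_congr {n m} {Γ : Ctx n m} {A A' t t' u u'} :
      Der Γ (tmEq A A' .univ) → Der Γ (tmEq t t' A) → Der Γ (tmEq u u' A) →
      Der Γ (tmEq (.path A t u) (.path A' t' u') .univ)
  | univ_Glue {n m} {Γ : Ctx n m} {φ T e A} :
      Der Γ (tm A .univ) → Der (Γ.face φ) (tm T .univ) → Der (Γ.face φ) (tm e (equiv T A)) →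
      Der Γ (tm (.Glue φ T e A) .univ)
  | univ_Glue_congr {n m} {Γ : Ctx n m} {φ φ' T T' e e' A A'} :
      Γ.FaceEq φ φ' → Der Γ (tmEq A A' .univ) → Der (Γ.face φ) (tmEq T T' .univ) →
      Der (Γ.face φ) (tmEq e e' (equiv T A)) →
      Der Γ (tmEq (.Glue φ T e A) (.Glue φ' T' e' A') .univ)
  | univ_Glue_top {n m} {Γ : Ctx n m} {T e A} :
      Der Γ (tm A .univ) → Der Γ (tm T .univ) → Der Γ (tm e (equiv T A)) →
      Der Γ (tmEq (.Glue ⊤ T e A) T .univ)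
  | comp_univ {n m} {Γ : Ctx n m} {φ E A₀} :
      Der (Γ.face φ).dim (tm E .univ) → Der Γ (tm A₀ .univ) →
      Der (Γ.face φ) (tmEq A₀ (E.dinst ⊥) .univ) →
      Der Γ (tmEq (.comp .univ φ E A₀) (.Glue φ (E.dinst ⊤) (equivLine E.inv) A₀) .univ)

end Cubical

/-! A type is contractible as soon as every partial element of it, given on a face φ, extends to a
total element that restricts to it strictly. Extending the empty partial element gives a centre, and
extending `[(i = 0) ↦ x, (i = 1) ↦ y]` gives a path from `x` to `y`. For `(X : U) × Equiv X A`, a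
partial element on φ is a partial type `T` with `e : Equiv T A`, which is exactly the input of
glueing. Its extension (`equivExt`) is `G = Glue [φ ↦ (T, e)] A` with the map `unglue : G → A`. On
φ, `G` is `T` and `unglue` is `e.1`, so what is needed is a proof that `unglue` is an equivalence
which is equal to `e.2` on φ.

Fix `a : A`. An element `(b, p)` of the fiber of `unglue` over `a`, given on a face ψ that contains
φ, extends to a total one (`fiberExt`). The partial path `p` from `a` extends to a total path from
`a` by a composition in `A`, and `b` on φ is glued to the end of that path. On ψ the end is `unglue
b`, so η for glueing returns `(b, p)`. Hence a proof `q` on φ that the fiber is contractible extends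
to a total proof (`fiberContr`): the centre `c` extends `q.1`, and the path from `c` to `v` extends
`[φ ↦ q.2 v i, (i = 0) ↦ c, (i = 1) ↦ v]`. This is used with `q = e.2 a`. The only compositions that
occur are in `A`, along constant lines.

The construction has to be carried out inside `Der`. Admissibility of substitution is never proved
by induction on derivations. Instead, the typing lemmas concern `Stable` judgments, those derivable
after every renaming of variables and substitution of names. By definition these are closed under
weakening, instantiation of names and rearrangement of restrictions, and the rules that are used
preserve them. The hypothesis `A : U` is merely derivable, so everything is done for a variable of
type `U`; abstracting over it and applying the result to `A` gives the theorem. -/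

namespace Cubical

open Tm Judgment

/-! ### Substitution in the interval and in the face lattice -/

section Interval

variable {m m' m'' : ℕ}

/-- The class of an expression in the interval. -/
def Dim.mk (a : DimExpr m) : Dim m := Quotient.mk _ a

/-- The class of an expression in the face lattice. -/
def Face.mk (a : FaceExpr m) : Face m := Quotient.mk _ a

theorem Dim.subst_subst (ρ : Fin m → Dim m') (ρ' : Fin m' → Dim m'') (r : Dim m) :
    (r.subst ρ).subst ρ' = r.subst fun i => (ρ i).subst ρ' := by
  have hneg (s : Dim m') : s.neg.subst ρ' = (s.subst ρ').neg := by rcases s with ⟨s⟩; rfl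
  have hinf (s t : Dim m') : (s ⊓ t).subst ρ' = s.subst ρ' ⊓ t.subst ρ' := by
    rcases s with ⟨s⟩; rcases t with ⟨t⟩; rfl
  have hsup (s t : Dim m') : (s ⊔ t).subst ρ' = s.subst ρ' ⊔ t.subst ρ' := by
    rcases s with ⟨s⟩; rcases t with ⟨t⟩; rfl
  rcases r with ⟨a⟩
  change Dim.subst ρ' (a.subst ρ) = a.subst _
  induction a with
  | zero => rfl
  | one => rfl
  | var i => rfl
  | neg r ih => simp only [DimExpr.subst, hneg, ih]
  | inf r s ih ih' => simp only [DimExpr.subst, hinf, ih, ih']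
  | sup r s ih ih' => simp only [DimExpr.subst, hsup, ih, ih']

theorem Dim.subst_inf (ρ : Fin m → Dim m') (r s : Dim m) :
    (r ⊓ s).subst ρ = r.subst ρ ⊓ s.subst ρ := by
  rcases r with ⟨r⟩; rcases s with ⟨s⟩; rfl

theorem Dim.subst_var (r : Dim m) : r.subst Dim.var = r := by
  rcases r with ⟨a⟩
  change a.subst _ = Dim.mk a
  induction a with
  | zero => rfl
  | one => rfl
  | var i => rfl
  | neg r ih => simp only [DimExpr.subst, ih]; rfl
  | inf r s ih ih' => simp only [DimExpr.subst, ih, ih']; rfl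
  | sup r s ih ih' => simp only [DimExpr.subst, ih, ih']; rfl

namespace Face

variable (ρ : Fin m → Dim m') (φ ψ : Face m)

theorem subst_sup : (φ ⊔ ψ).subst ρ = φ.subst ρ ⊔ ψ.subst ρ := by
  rcases φ with ⟨φ⟩; rcases ψ with ⟨ψ⟩; rfl

theorem subst_inf : (φ ⊓ ψ).subst ρ = φ.subst ρ ⊓ ψ.subst ρ := by
  rcases φ with ⟨φ⟩; rcases ψ with ⟨ψ⟩; rfl

variable {φ ψ} in
theorem subst_mono (h : φ ≤ ψ) : φ.subst ρ ≤ ψ.subst ρ := by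
  rw [← sup_eq_right] at h ⊢
  rw [← subst_sup, h]

theorem subst_finset_sup {k : ℕ} (φ : Fin k → Face m) :
    (Finset.univ.sup φ).subst ρ = Finset.univ.sup fun l => (φ l).subst ρ := by
  refine Finset.induction_on Finset.univ (by simp only [Finset.sup_empty]; rfl) ?_
  intro l s _ ih
  rw [Finset.sup_insert, Finset.sup_insert, subst_sup, ih]

end Face

/-- The two faces are treated together because negation exchanges them. -/
theorem DimExpr.faces_subst (ρ : Fin m → Dim m') (a : DimExpr m) :
    (a.subst ρ).isZero = a.faces.1.subst ρ ∧ (a.subst ρ).isOne = a.faces.2.subst ρ := by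
  have h (s t : Dim m') : (s ⊓ t).isZero = s.isZero ⊔ t.isZero ∧
      (s ⊓ t).isOne = s.isOne ⊓ t.isOne ∧ (s ⊔ t).isZero = s.isZero ⊓ t.isZero ∧
      (s ⊔ t).isOne = s.isOne ⊔ t.isOne ∧ s.neg.isZero = s.isOne ∧ s.neg.isOne = s.isZero := by
    rcases s with ⟨s⟩; rcases t with ⟨t⟩; exact ⟨rfl, rfl, rfl, rfl, rfl, rfl⟩
  induction a with
  | zero => exact ⟨rfl, rfl⟩
  | one => exact ⟨rfl, rfl⟩
  | var i => exact ⟨rfl, rfl⟩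
  | neg r ih => exact ⟨(h _ ⊥).2.2.2.2.1.trans ih.2, (h _ ⊥).2.2.2.2.2.trans ih.1⟩
  | inf r s ih ih' =>
    simp only [DimExpr.subst, faces, h, ih, ih', Face.subst_sup, Face.subst_inf, and_self]
  | sup r s ih ih' =>
    simp only [DimExpr.subst, faces, h, ih, ih', Face.subst_sup, Face.subst_inf, and_self]

theorem Dim.isZero_inf (r s : Dim m) : (r ⊓ s).isZero = r.isZero ⊔ s.isZero := by
  rcases r with ⟨r⟩; rcases s with ⟨s⟩; rfl

theorem Dim.isZero_subst (ρ : Fin m → Dim m') (r : Dim m) :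
    (r.subst ρ).isZero = r.isZero.subst ρ := by
  rcases r with ⟨a⟩; exact (a.faces_subst ρ).1

theorem Dim.isOne_subst (ρ : Fin m → Dim m') (r : Dim m) :
    (r.subst ρ).isOne = r.isOne.subst ρ := by
  rcases r with ⟨a⟩; exact (a.faces_subst ρ).2

theorem Face.subst_subst (ρ : Fin m → Dim m') (ρ' : Fin m' → Dim m'') (φ : Face m) :
    (φ.subst ρ).subst ρ' = φ.subst fun i => (ρ i).subst ρ' := by
  rcases φ with ⟨a⟩
  change Face.subst ρ' (a.eval (L := Face m') _ _) = a.eval (L := Face m'') _ _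
  induction a with
  | bot => rfl
  | top => rfl
  | eq0 i => exact (Dim.isZero_subst _ _).symm
  | eq1 i => exact (Dim.isOne_subst _ _).symm
  | inf r s ih ih' => simp only [FaceExpr.eval, Face.subst_inf, ih, ih']
  | sup r s ih ih' => simp only [FaceExpr.eval, Face.subst_sup, ih, ih']

theorem Face.subst_var (φ : Face m) : φ.subst Dim.var = φ := by
  rcases φ with ⟨a⟩
  change a.eval (L := Face m) _ _ = Face.mk a
  induction a with
  | bot => rfl
  | top => rfl
  | eq0 i => rfl
  | eq1 i => rfl
  | inf r s ih ih' => simp only [FaceExpr.eval, ih, ih']; rfl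
  | sup r s ih ih' => simp only [FaceExpr.eval, ih, ih']; rfl

/-- This is `cover` with both faces equal to ψ. -/
theorem Dim.EqMod.mono {φ ψ : Face m} {r s : Dim m} (h : φ ≤ ψ) (hr : EqMod ψ r s) :
    EqMod φ r s :=
  .cover (φ₁ := ψ) (φ₂ := ψ) (by rwa [sup_idem]) hr hr

/-- Links the face lattice with equality in the interval: on the face `(r = b)` the element `r` may
be replaced by `b`. A face of a meet or join is either a join of faces, handled by `cover`, or a
meet of faces, handled by `mono`. -/
theorem DimExpr.eqMod_faces (a : DimExpr m) :
    Dim.EqMod a.faces.1 (Dim.mk a) ⊥ ∧ Dim.EqMod a.faces.2 (Dim.mk a) ⊤ := by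
  induction a with
  | zero => exact ⟨.refl _, .empty _ _⟩
  | one => exact ⟨.empty _ _, .refl _⟩
  | var i => exact ⟨.eq0 i le_rfl, .eq1 i le_rfl⟩
  | neg r ih =>
    have h₀ := ih.1.neg
    have h₁ := ih.2.neg
    rw [Dim.neg_bot] at h₀
    rw [Dim.neg_top] at h₁
    exact ⟨h₁, h₀⟩
  | inf r s ih ih' =>
    have h₀ := ih.1.inf (.refl (Dim.mk s))
    have h₀' := Dim.EqMod.inf (.refl (Dim.mk r)) ih'.1
    have h₁ := (ih.2.mono (inf_le_left (b := s.faces.2))).inf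
      (ih'.2.mono (inf_le_right (a := r.faces.2)))
    rw [bot_inf_eq] at h₀
    rw [inf_bot_eq] at h₀'
    rw [inf_top_eq] at h₁
    exact ⟨.cover le_rfl h₀ h₀', h₁⟩
  | sup r s ih ih' =>
    have h₀ := ih.2.sup (.refl (Dim.mk s))
    have h₀' := Dim.EqMod.sup (.refl (Dim.mk r)) ih'.2
    have h₁ := (ih.1.mono (inf_le_left (b := s.faces.1))).sup
      (ih'.1.mono (inf_le_right (a := r.faces.1)))
    rw [top_sup_eq] at h₀
    rw [sup_top_eq] at h₀'
    rw [sup_bot_eq] at h₁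
    exact ⟨h₁, .cover le_rfl h₀ h₀'⟩

theorem Dim.eqMod_isZero (r : Dim m) : EqMod r.isZero r ⊥ := by
  rcases r with ⟨a⟩; exact a.eqMod_faces.1

theorem Dim.eqMod_isOne (r : Dim m) : EqMod r.isOne r ⊤ := by
  rcases r with ⟨a⟩; exact a.eqMod_faces.2

end Interval

/-! ### Renaming and substitution of terms -/

section Terms

variable {n n' n'' m m' m'' : ℕ}

theorem liftVar_comp (ξ : Fin n → Fin n') (ξ' : Fin n' → Fin n'') :
    (fun i => liftVar ξ' (liftVar ξ i)) = liftVar fun i => ξ' (ξ i) := by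
  funext i; refine Fin.cases rfl (fun _ => rfl) i

theorem liftVar_id : liftVar (fun i : Fin n => i) = fun i => i := by
  funext i; refine Fin.cases rfl (fun _ => rfl) i

theorem liftDim_subst (ρ : Fin m → Dim m') (ρ' : Fin m' → Dim m'') :
    (fun i => (liftDim ρ i).subst (liftDim ρ')) = liftDim fun i => (ρ i).subst ρ' := by
  funext i
  refine Fin.cases rfl (fun j => ?_) i
  change ((ρ j).wk).subst _ = ((ρ j).subst ρ').wk
  rw [Dim.wk, Dim.wk, Dim.subst_subst, Dim.subst_subst]
  rfl

theorem liftDim_var : liftDim (Dim.var : Fin m → Dim m) = Dim.var := by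
  funext i; refine Fin.cases rfl (fun _ => rfl) i

namespace Tm

theorem ren_ren (ξ : Fin n → Fin n') (ρ : Fin m → Dim m') (ξ' : Fin n' → Fin n'')
    (ρ' : Fin m' → Dim m'') (t : Tm n m) :
    (t.ren ξ ρ).ren ξ' ρ' = t.ren (fun i => ξ' (ξ i)) fun i => (ρ i).subst ρ' := by
  induction t generalizing n' n'' m' m'' <;>
    simp_all only [ren, liftVar_comp, liftDim_subst, Dim.subst_subst, Face.subst_subst]

theorem ren_id (t : Tm n m) : t.ren (fun i => i) Dim.var = t := by
  induction t <;> simp_all only [ren, liftVar_id, liftDim_var, Dim.subst_var, Face.subst_var]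

theorem ren_subst (ξ : Fin n → Fin n') (ρ : Fin m → Dim m') (σ : Fin n' → Tm n'' m'')
    (ρ' : Fin m' → Dim m'') (t : Tm n m) :
    (t.ren ξ ρ).subst σ ρ' = t.subst (fun i => σ (ξ i)) fun i => (ρ i).subst ρ' := by
  have h {n n' n'' m''} (ξ : Fin n → Fin n') (σ : Fin n' → Tm n'' m'') :
      (fun i => (Matrix.vecCons (var 0) fun i => (σ i).wk : Fin (n' + 1) → _) (liftVar ξ i)) =
        Matrix.vecCons (var 0) fun i => (σ (ξ i)).wk := by
    funext i; refine Fin.cases rfl (fun _ => rfl) i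
  induction t generalizing n' n'' m' m'' <;>
    simp_all only [ren, subst, liftDim_subst, Dim.subst_subst, Face.subst_subst]

theorem wk_ren (ξ : Fin n → Fin n') (ρ : Fin m → Dim m') (t : Tm n m) :
    t.wk.ren (liftVar ξ) ρ = (t.ren ξ ρ).wk := by
  rw [wk, wk, ren_ren, ren_ren]
  exact congrArg (fun ρ' => t.ren _ ρ') (funext fun i => (Dim.subst_var _).symm)

theorem wkD_ren (ξ : Fin n → Fin n') (ρ : Fin m → Dim m') (t : Tm n m) :
    t.wkD.ren ξ (liftDim ρ) = (t.ren ξ ρ).wkD := by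
  rw [wkD, dsubst, wkD, dsubst, ren_ren, ren_ren]
  rfl

theorem subst_ren (σ : Fin n → Tm n' m') (ρ : Fin m → Dim m') (ξ : Fin n' → Fin n'')
    (ρ' : Fin m' → Dim m'') (t : Tm n m) :
    (t.subst σ ρ).ren ξ ρ' = t.subst (fun i => (σ i).ren ξ ρ') fun i => (ρ i).subst ρ' := by
  have h {n n' n'' m' m''} (σ : Fin n → Tm n' m') (ξ : Fin n' → Fin n'') (ρ' : Fin m' → Dim m'') :
      (fun i => ((Matrix.vecCons (var 0) fun i => (σ i).wk : Fin (n + 1) → _) i).ren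
        (liftVar ξ) ρ') = Matrix.vecCons (var 0) fun i => ((σ i).ren ξ ρ').wk := by
    funext i; refine Fin.cases rfl (fun _ => wk_ren _ _ _) i
  induction t generalizing n' n'' m' m'' <;>
    simp_all only [ren, subst, liftDim_subst, Dim.subst_subst, Face.subst_subst, wkD_ren]

theorem subst_var (t : Tm n m) : t.subst var Dim.var = t := by
  have h {n m} : (Matrix.vecCons (var 0) fun i => (var i).wk : Fin (n + 1) → Tm (n + 1) m) =
      var := by
    funext i; refine Fin.cases rfl (fun _ => rfl) i
  have h' {n m} : (fun i => (var i).wkD : Fin n → Tm n (m + 1)) = var := rfl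
  induction t <;>
    simp_all only [subst, liftDim_var, Dim.subst_var, Face.subst_var]

theorem wk_inst (t u : Tm n m) : t.wk.inst u = t := by
  rw [wk, inst, ren_subst]
  exact t.subst_var

theorem wkD_dinst (t : Tm n m) (r : Dim m) : t.wkD.dinst r = t := by
  rw [wkD, dinst, dsubst, dsubst, ren_ren]
  exact t.ren_id

theorem inst_ren (ξ : Fin n → Fin n') (ρ : Fin m → Dim m') (B : Tm (n + 1) m) (u : Tm n m) :
    (B.inst u).ren ξ ρ = (B.ren (liftVar ξ) ρ).inst (u.ren ξ ρ) := by
  rw [inst, inst, subst_ren, ren_subst]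
  congr 1
  · funext i; refine Fin.cases rfl (fun _ => rfl) i
  · funext i; exact (Dim.subst_var _).symm

theorem dinst_ren (ξ : Fin n → Fin n') (ρ : Fin m → Dim m') (t : Tm n (m + 1)) (r : Dim m) :
    (t.dinst r).ren ξ ρ = (t.ren ξ (liftDim ρ)).dinst (r.subst ρ) := by
  rw [dinst, dinst, dsubst, dsubst, ren_ren, ren_ren]
  congr 1
  funext i
  refine Fin.cases rfl (fun j => ?_) i
  change ρ j = ((ρ j).wk).subst _
  rw [Dim.wk, Dim.subst_subst]
  exact (Dim.subst_var _).symm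

end Tm

end Terms

/-! ### Renaming of the derived type formers -/

section Rules

variable {n n' n'' m m' m'' : ℕ}

theorem liftVar_zero (ξ : Fin n → Fin n') : liftVar ξ 0 = 0 := rfl

theorem subst_liftDim_zero (ρ : Fin m → Dim m') :
    (Dim.var 0).subst (liftDim ρ) = .var 0 := rfl

theorem Dim.subst_bot (ρ : Fin m → Dim m') : (⊥ : Dim m).subst ρ = ⊥ := rfl

theorem Dim.subst_top (ρ : Fin m → Dim m') : (⊤ : Dim m).subst ρ = ⊤ := rfl

attribute [simp] Tm.ren liftVar_zero subst_liftDim_zero Dim.subst_bot Dim.subst_top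
  wk_ren wkD_ren inst_ren dinst_ren wk_inst wkD_dinst Dim.subst_var
  Face.subst_var

namespace Tm

variable (ξ : Fin n → Fin n') (ρ : Fin m → Dim m') (T A B f y : Tm n m)

theorem arrow_ren : (arrow A B).ren ξ ρ = arrow (A.ren ξ ρ) (B.ren ξ ρ) := by
  simp [arrow]

theorem isContr_ren : (isContr A).ren ξ ρ = isContr (A.ren ξ ρ) := by
  simp [isContr]; rfl

theorem fiber_ren : (fiber T A f y).ren ξ ρ =
    fiber (T.ren ξ ρ) (A.ren ξ ρ) (f.ren ξ ρ) (y.ren ξ ρ) := by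
  simp [fiber]

theorem isEquiv_ren : (isEquiv T A f).ren ξ ρ =
    isEquiv (T.ren ξ ρ) (A.ren ξ ρ) (f.ren ξ ρ) := by
  simp [isEquiv, isContr_ren, fiber_ren]

theorem equiv_ren : (equiv T A).ren ξ ρ = equiv (T.ren ξ ρ) (A.ren ξ ρ) := by
  simp [equiv, arrow_ren, isEquiv_ren]

end Tm

/-! ### Renamings of contexts and stable judgments -/

def Judgment.ren (ξ : Fin n → Fin n') (ρ : Fin m → Dim m') : Judgment n m → Judgment n' m'
  | ctx => ctx
  | ty A => ty (A.ren ξ ρ)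
  | tyEq A B => tyEq (A.ren ξ ρ) (B.ren ξ ρ)
  | tm t A => tm (t.ren ξ ρ) (A.ren ξ ρ)
  | tmEq t u A => tmEq (t.ren ξ ρ) (u.ren ξ ρ) (A.ren ξ ρ)

attribute [simp] Judgment.ren

theorem Judgment.ren_ren (ξ : Fin n → Fin n') (ρ : Fin m → Dim m') (ξ' : Fin n' → Fin n'')
    (ρ' : Fin m' → Dim m'') (J : Judgment n m) :
    (J.ren ξ ρ).ren ξ' ρ' = J.ren (fun i => ξ' (ξ i)) fun i => (ρ i).subst ρ' := by
  cases J <;> simp only [Judgment.ren, Tm.ren_ren]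

theorem Judgment.ren_id (J : Judgment n m) : J.ren (fun i => i) Dim.var = J := by
  cases J <;> simp only [Judgment.ren, Tm.ren_id]

/-- `(ξ, ρ)` is a morphism of contexts from `Δ` to `Γ` given by variables and elements of the
interval. -/
structure Ctx.Ren (Γ : Ctx n m) (Δ : Ctx n' m') (ξ : Fin n → Fin n') (ρ : Fin m → Dim m') :
    Prop where
  lookup : ∀ x, Δ.lookup (ξ x) = (Γ.lookup x).ren ξ ρ
  restr : Δ.restr ≤ Γ.restr.subst ρ

namespace Ctx.Ren

variable {Γ : Ctx n m} {Δ : Ctx n' m'} {Θ : Ctx n'' m''} {ξ : Fin n → Fin n'}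
  {ρ : Fin m → Dim m'} {ξ' : Fin n' → Fin n''} {ρ' : Fin m' → Dim m''}

theorem comp (h : Γ.Ren Δ ξ ρ) (h' : Δ.Ren Θ ξ' ρ') :
    Γ.Ren Θ (fun i => ξ' (ξ i)) fun i => (ρ i).subst ρ' where
  lookup x := by rw [h'.lookup, h.lookup, Tm.ren_ren]
  restr := by
    rw [← Face.subst_subst]
    exact h'.restr.trans (Face.subst_mono _ h.restr)

theorem liftTm (h : Γ.Ren Δ ξ ρ) (A : Tm n m) :
    (Γ.tm A).Ren (Δ.tm (A.ren ξ ρ)) (liftVar ξ) ρ where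
  lookup x := by
    refine Fin.cases (wk_ren ξ ρ A).symm (fun y => ?_) x
    change (Δ.lookup (ξ y)).wk = ((Γ.lookup y).wk).ren _ _
    rw [wk_ren, h.lookup]
  restr := h.restr

theorem liftDim (h : Γ.Ren Δ ξ ρ) : Γ.dim.Ren Δ.dim ξ (liftDim ρ) where
  lookup x := by
    change (Δ.lookup (ξ x)).wkD = ((Γ.lookup x).wkD).ren _ _
    rw [wkD_ren, h.lookup]
  restr := by
    change Δ.restr.wk ≤ (Γ.restr.wk).subst _
    refine (Face.subst_mono _ h.restr).trans (le_of_eq ?_)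
    rw [Face.wk, Face.subst_subst, Face.subst_subst]
    rfl

theorem face (h : Γ.Ren Δ ξ ρ) (φ : Face m) : (Γ.face φ).Ren (Δ.face (φ.subst ρ)) ξ ρ where
  lookup := h.lookup
  restr := by
    change Δ.restr ⊓ _ ≤ (Γ.restr ⊓ φ).subst ρ
    rw [Face.subst_inf]
    exact inf_le_inf_right _ h.restr

theorem le_subst (h : Γ.Ren Δ ξ ρ) {φ : Face m} (hφ : Γ.restr ≤ φ) : Δ.restr ≤ φ.subst ρ :=
  h.restr.trans (Face.subst_mono _ hφ)

theorem succ (Γ : Ctx n m) (A : Tm n m) : Γ.Ren (Γ.tm A) Fin.succ Dim.var where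
  lookup _ := rfl
  restr := by rw [Face.subst_var]; rfl

theorem succDim (Γ : Ctx n m) : Γ.Ren Γ.dim (fun i => i) fun i => .var i.succ where
  lookup _ := rfl
  restr := le_rfl

/-- Names may be sent to arbitrary elements of the interval, so instantiating a name counts as a
renaming. -/
theorem inst (Γ : Ctx n m) (r : Dim m) :
    Γ.dim.Ren Γ (fun i => i) (Matrix.vecCons r Dim.var) where
  lookup x := (wkD_dinst (Γ.lookup x) r).symm
  restr := by
    change _ ≤ (Γ.restr.wk).subst _
    rw [Face.wk, Face.subst_subst]
    exact le_of_eq Γ.restr.subst_var.symm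

end Ctx.Ren

/-- `Γ ⊢ J` is derivable after every renaming into a well-formed context. -/
def Stable (Γ : Ctx n m) (J : Judgment n m) : Prop :=
  ∀ ⦃n' m' : ℕ⦄ ⦃Δ : Ctx n' m'⦄ ⦃ξ : Fin n → Fin n'⦄ ⦃ρ : Fin m → Dim m'⦄,
    Γ.Ren Δ ξ ρ → Der Δ ctx → Der Δ (J.ren ξ ρ)

theorem Ctx.faceEq_top {Γ : Ctx n m} {φ : Face m} (h : Γ.restr ≤ φ) : Γ.FaceEq φ ⊤ := by
  rw [Ctx.FaceEq, inf_top_eq, inf_eq_left.2 h]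

/-- A cover by one face: a restriction that the context already implies can be dropped. -/
theorem Der.of_face {Γ : Ctx n m} {J : Judgment n m} {φ : Face m} (hΓ : Der Γ ctx)
    (hφ : Γ.restr ≤ φ) (h : Der (Γ.face φ) J) : Der Γ J :=
  .patch (k := 1) (fun _ => φ) hΓ
    (Ctx.faceEq_top (hφ.trans (Finset.le_sup (f := fun _ => φ) (Finset.mem_univ (0 : Fin 1)))))
    fun _ => h

namespace Stable

variable {Γ : Ctx n m} {J : Judgment n m}

theorem der (h : Stable Γ J) (hΓ : Der Γ ctx) : Der Γ J := by
  have hr : Γ.Ren Γ (fun i => i) Dim.var :=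
    ⟨fun x => (Tm.ren_id _).symm, le_of_eq (Face.subst_var _).symm⟩
  have := h hr hΓ
  rwa [Judgment.ren_id] at this

theorem ren {Δ : Ctx n' m'} {ξ ρ} (h : Stable Γ J) (hr : Γ.Ren Δ ξ ρ) :
    Stable Δ (J.ren ξ ρ) := by
  intro _ _ _ _ _ hr' hc
  rw [Judgment.ren_ren]
  exact h (hr.comp hr') hc

theorem wk {A : Tm n m} (h : Stable Γ J) : Stable (Γ.tm A) (J.ren Fin.succ Dim.var) :=
  h.ren (.succ Γ A)

theorem wkD (h : Stable Γ J) : Stable Γ.dim (J.ren (fun i => i) fun i => .var i.succ) :=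
  h.ren (.succDim Γ)

theorem dinst {J : Judgment n (m + 1)} (r : Dim m) (h : Stable Γ.dim J) :
    Stable Γ (J.ren (fun i => i) (Matrix.vecCons r Dim.var)) :=
  h.ren (.inst Γ r)

/-- Stable judgments only depend on the types of the variables and the restriction. -/
theorem restrict {Δ : Ctx n m} (h : Stable Γ J) (hr : Δ.restr ≤ Γ.restr)
    (hl : ∀ x, Δ.lookup x = Γ.lookup x := by exact fun _ => rfl) : Stable Δ J := by
  have hr : Γ.Ren Δ (fun i => i) Dim.var :=
    ⟨fun x => (hl x).trans (Tm.ren_id _).symm, hr.trans (le_of_eq (Face.subst_var _).symm)⟩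
  have := h.ren hr
  rwa [Judgment.ren_id] at this

theorem face {φ : Face m} (h : Stable Γ J) : Stable (Γ.face φ) J :=
  h.restrict inf_le_left

/-- The empty cover. It types the empty system and makes compatibility of systems on disjoint faces
vacuous. -/
theorem of_le_bot (h : Γ.restr ≤ ⊥) : Stable Γ J := fun _ _ _ _ _ hr hc =>
  .patch (k := 0) ![] hc (Ctx.faceEq_top (hr.le_subst h)) fun l => l.elim0

theorem cover {φ ψ : Face m} (h : Γ.restr ≤ φ ⊔ ψ) (hφ : Stable (Γ.face φ) J)
    (hψ : Stable (Γ.face ψ) J) : Stable Γ J := by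
  intro _ _ Δ ξ ρ hr hc
  refine .patch ![φ.subst ρ, ψ.subst ρ] hc (Ctx.faceEq_top ?_) fun l => ?_
  · refine (hr.le_subst h).trans ?_
    rw [Face.subst_sup]
    exact sup_le (Finset.le_sup (f := ![φ.subst ρ, ψ.subst ρ]) (Finset.mem_univ 0))
      (Finset.le_sup (f := ![φ.subst ρ, ψ.subst ρ]) (Finset.mem_univ 1))
  · refine Fin.cases (hφ (hr.face φ) hc.ctx_face) (fun l => ?_) l
    refine Fin.cases (hψ (hr.face ψ) hc.ctx_face) (fun l => l.elim0) l

/-! ### Stable forms of the rules -/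

variable {A A' B B' C T e : Tm n m} {t t' u u' v a b : Tm n m} {P P' : Tm (n + 1) m}
  {q q' : Tm (n + 1) m} {φ φ' : Face m}

theorem ty_refl (h : Stable Γ (ty A)) : Stable Γ (tyEq A A) := fun _ _ _ _ _ hr hc =>
  .ty_refl (h hr hc)

theorem ty_symm (h : Stable Γ (tyEq A B)) : Stable Γ (tyEq B A) := fun _ _ _ _ _ hr hc =>
  .ty_symm (h hr hc)

theorem refl (h : Stable Γ (tm t A)) : Stable Γ (tmEq t t A) := fun _ _ _ _ _ hr hc =>
  .tm_refl (h hr hc)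

theorem symm (h : Stable Γ (tmEq t u A)) : Stable Γ (tmEq u t A) := fun _ _ _ _ _ hr hc =>
  .tm_symm (h hr hc)

theorem trans (h : Stable Γ (tmEq t u A)) (h' : Stable Γ (tmEq u v A)) :
    Stable Γ (tmEq t v A) := fun _ _ _ _ _ hr hc => .tm_trans (h hr hc) (h' hr hc)

theorem conv (h : Stable Γ (tm t A)) (h' : Stable Γ (tyEq A B)) : Stable Γ (tm t B) :=
  fun _ _ _ _ _ hr hc => .tm_conv (h hr hc) (h' hr hc)

/-- Variables are where stability starts: a renaming sends a variable to a variable whose type is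
the renamed one. -/
theorem var (x : Fin n) : Stable Γ (tm (.var x) (Γ.lookup x)) := by
  intro _ _ Δ ξ ρ hr hc
  have := Der.var (ξ x) hc
  rwa [hr.lookup] at this

theorem var_zero : Stable (Γ.tm A) (tm (.var 0) A.wk) := var 0

theorem pi (hA : Stable Γ (ty A)) (hP : Stable (Γ.tm A) (ty P)) : Stable Γ (ty (.pi A P)) :=
  fun _ _ _ _ _ hr hc => .pi (hA hr hc) (hP (hr.liftTm A) (.ctx_tm (hA hr hc)))

/-- A stable judgment yields derivations in well-formed contexts only. The premise that `A` is a
type, which the rule itself lacks, makes the extended context well formed; the same holds for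
several rules below. -/
theorem pi_congr (hA : Stable Γ (ty A)) (h : Stable Γ (tyEq A A'))
    (hP : Stable (Γ.tm A) (tyEq P P')) : Stable Γ (tyEq (.pi A P) (.pi A' P')) :=
  fun _ _ _ _ _ hr hc => .pi_congr (h hr hc) (hP (hr.liftTm A) (.ctx_tm (hA hr hc)))

theorem lam (hA : Stable Γ (ty A)) (h : Stable (Γ.tm A) (tm q P)) :
    Stable Γ (tm (.lam A q) (.pi A P)) :=
  fun _ _ _ _ _ hr hc => .lam (hA hr hc) (h (hr.liftTm A) (.ctx_tm (hA hr hc)))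

theorem app (ht : Stable Γ (tm t (.pi A P))) (hu : Stable Γ (tm u A)) :
    Stable Γ (tm (.app t u) (P.inst u)) := fun _ _ _ _ _ hr hc => by
  simpa using Der.app (ht hr hc) (hu hr hc)

theorem app_congr (ht : Stable Γ (tmEq t t' (.pi A P))) (hu : Stable Γ (tmEq u u' A)) :
    Stable Γ (tmEq (.app t u) (.app t' u') (P.inst u)) := fun _ _ _ _ _ hr hc => by
  simpa using Der.app_congr (ht hr hc) (hu hr hc)

theorem pi_beta (hA : Stable Γ (ty A)) (h : Stable (Γ.tm A) (tm q P)) (hu : Stable Γ (tm u A)) :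
    Stable Γ (tmEq (.app (.lam A q) u) (q.inst u) (P.inst u)) := fun _ _ _ _ _ hr hc => by
  simpa using Der.pi_beta (h (hr.liftTm A) (.ctx_tm (hA hr hc))) (hu hr hc)

theorem pi_eta (hA : Stable Γ (ty A)) (ht : Stable Γ (tm t (.pi A P)))
    (hu : Stable Γ (tm u (.pi A P)))
    (h : Stable (Γ.tm A) (tmEq (.app t.wk (.var 0)) (.app u.wk (.var 0)) P)) :
    Stable Γ (tmEq t u (.pi A P)) := fun _ _ _ _ _ hr hc => by
  refine .pi_eta (ht hr hc) (hu hr hc) ?_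
  simpa using h (hr.liftTm A) (.ctx_tm (hA hr hc))

theorem sigma (hA : Stable Γ (ty A)) (hP : Stable (Γ.tm A) (ty P)) :
    Stable Γ (ty (.sigma A P)) :=
  fun _ _ _ _ _ hr hc => .sigma (hA hr hc) (hP (hr.liftTm A) (.ctx_tm (hA hr hc)))

theorem sigma_congr (hA : Stable Γ (ty A)) (h : Stable Γ (tyEq A A'))
    (hP : Stable (Γ.tm A) (tyEq P P')) : Stable Γ (tyEq (.sigma A P) (.sigma A' P')) :=
  fun _ _ _ _ _ hr hc => .sigma_congr (h hr hc) (hP (hr.liftTm A) (.ctx_tm (hA hr hc)))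

theorem pair (hA : Stable Γ (ty A)) (hP : Stable (Γ.tm A) (ty P)) (ht : Stable Γ (tm t A))
    (hu : Stable Γ (tm u (P.inst t))) : Stable Γ (tm (.pair t u) (.sigma A P)) :=
  fun _ _ _ _ _ hr hc =>
    .pair (hP (hr.liftTm A) (.ctx_tm (hA hr hc))) (ht hr hc) (by simpa using hu hr hc)

theorem pair_congr (hA : Stable Γ (ty A)) (hP : Stable (Γ.tm A) (ty P))
    (ht : Stable Γ (tmEq t t' A)) (hu : Stable Γ (tmEq u u' (P.inst t))) :
    Stable Γ (tmEq (.pair t u) (.pair t' u') (.sigma A P)) := fun _ _ _ _ _ hr hc =>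
  .pair_congr (hP (hr.liftTm A) (.ctx_tm (hA hr hc))) (ht hr hc) (by simpa using hu hr hc)

theorem fst (h : Stable Γ (tm t (.sigma A P))) : Stable Γ (tm (.fst t) A) :=
  fun _ _ _ _ _ hr hc => .fst (h hr hc)

theorem snd (h : Stable Γ (tm t (.sigma A P))) : Stable Γ (tm (.snd t) (P.inst (.fst t))) :=
  fun _ _ _ _ _ hr hc => by simpa using Der.snd (h hr hc)

/-- Surjective pairing. -/
theorem pair_eta (hA : Stable Γ (ty A)) (hP : Stable (Γ.tm A) (ty P))
    (ht : Stable Γ (tm t (.sigma A P))) :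
    Stable Γ (tmEq (.pair (.fst t) (.snd t)) t (.sigma A P)) := fun _ _ _ _ _ hr hc => by
  have hP := hP (hr.liftTm A) (.ctx_tm (hA hr hc))
  have ht := ht hr hc
  simpa using Der.tm_symm (.sigma_eta ht (.pair hP (.fst ht) (.snd ht)) hP
    (.tm_symm (.fst_beta hP (.fst ht) (.snd ht))) (.tm_symm (.snd_beta hP (.fst ht) (.snd ht))))

theorem path (hA : Stable Γ (ty A)) (ht : Stable Γ (tm t A)) (hu : Stable Γ (tm u A)) :
    Stable Γ (ty (.path A t u)) :=
  fun _ _ _ _ _ hr hc => .path (hA hr hc) (ht hr hc) (hu hr hc)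

theorem path_congr (hA : Stable Γ (tyEq A A')) (ht : Stable Γ (tmEq t t' A))
    (hu : Stable Γ (tmEq u u' A)) : Stable Γ (tyEq (.path A t u) (.path A' t' u')) :=
  fun _ _ _ _ _ hr hc => .path_congr (hA hr hc) (ht hr hc) (hu hr hc)

/-- Path abstraction with prescribed end points. -/
theorem plam {q : Tm n (m + 1)} (hA : Stable Γ (ty A)) (h : Stable Γ.dim (tm q A.wkD))
    (h₀ : Stable Γ (tmEq (q.dinst ⊥) a A)) (h₁ : Stable Γ (tmEq (q.dinst ⊤) b A)) :
    Stable Γ (tm (.plam q) (.path A a b)) := by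
  refine conv (fun _ _ _ _ _ hr hc => ?_) (path_congr hA.ty_refl h₀ h₁)
  simpa using Der.plam (hA hr hc) (by simpa using h hr.liftDim hc.ctx_dim)

theorem papp (r : Dim m) (h : Stable Γ (tm t (.path A a b))) : Stable Γ (tm (.papp t r) A) :=
  fun _ _ _ _ _ hr hc => .papp _ (h hr hc)

theorem path_beta {q : Tm n (m + 1)} (r : Dim m) (hA : Stable Γ (ty A))
    (h : Stable Γ.dim (tm q A.wkD)) : Stable Γ (tmEq (.papp (.plam q) r) (q.dinst r) A) :=
  fun _ _ _ _ _ hr hc => by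
    simpa using Der.path_beta _ (hA hr hc) (by simpa using h hr.liftDim hc.ctx_dim)

theorem path_eta (ht : Stable Γ (tm t (.path A a b))) (hu : Stable Γ (tm u (.path A a b)))
    (h : Stable Γ.dim (tmEq (.papp t.wkD (.var 0)) (.papp u.wkD (.var 0)) A.wkD)) :
    Stable Γ (tmEq t u (.path A a b)) := fun _ _ _ _ _ hr hc =>
  .path_eta (ht hr hc) (hu hr hc) (by simpa using h hr.liftDim hc.ctx_dim)

/-- The restriction makes `r` equal to `0`, so congruence reduces the claim to the rule for the end
point. -/
theorem papp_isZero {r : Dim m} (hr : Γ.restr ≤ r.isZero) (h : Stable Γ (tm t (.path A a b))) :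
    Stable Γ (tmEq (.papp t r) a A) := fun _ _ _ _ ρ hr' hc => by
  refine .tm_trans (.papp_congr (.tm_refl (h hr' hc)) ((r.subst ρ).eqMod_isZero.mono ?_))
    (.papp_zero (h hr' hc))
  rw [Dim.isZero_subst]
  exact hr'.le_subst hr

theorem papp_isOne {r : Dim m} (hr : Γ.restr ≤ r.isOne) (h : Stable Γ (tm t (.path A a b))) :
    Stable Γ (tmEq (.papp t r) b A) := fun _ _ _ _ ρ hr' hc => by
  refine .tm_trans (.papp_congr (.tm_refl (h hr' hc)) ((r.subst ρ).eqMod_isOne.mono ?_))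
    (.papp_one (h hr' hc))
  rw [Dim.isOne_subst]
  exact hr'.le_subst hr

theorem sys {k : ℕ} {φ : Fin k → Face m} {s : Fin k → Tm n m} (hA : Stable Γ (ty A))
    (hφ : Γ.restr ≤ Finset.univ.sup φ) (hs : ∀ l, Stable (Γ.face (φ l)) (tm (s l) A))
    (h : ∀ l l', Stable (Γ.face (φ l ⊓ φ l')) (tmEq (s l) (s l') A)) :
    Stable Γ (tm (.sys k φ s) A) := fun _ _ _ _ ρ hr hc => by
  refine .sys (hA hr hc) (Ctx.faceEq_top ?_) (fun l => hs l (hr.face _) hc.ctx_face)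
    fun l l' => ?_
  · rw [← Face.subst_finset_sup]
    exact hr.le_subst hφ
  · have := h l l' (hr.face _) hc.ctx_face
    rwa [Face.subst_inf] at this

theorem sys_eq {k : ℕ} {φ : Fin k → Face m} {s : Fin k → Tm n m} (l : Fin k)
    (hs : Stable Γ (tm (.sys k φ s) A)) (hφ : Γ.restr ≤ φ l) :
    Stable Γ (tmEq (.sys k φ s) (s l) A) := fun _ _ _ _ ρ hr hc =>
  have hl := hr.le_subst hφ
  .sys_eq l (Ctx.faceEq_top (hl.trans (Finset.le_sup (f := fun l => (φ l).subst ρ)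
    (Finset.mem_univ l)))) (hs hr hc) (Ctx.faceEq_top hl)

/-! ### Compositions -/

section Comp

variable {L s : Tm n (m + 1)}

theorem comp (hL : Stable Γ.dim (ty L)) (hs : Stable (Γ.face φ).dim (tm s L))
    (ha : Stable Γ (tm a (L.dinst ⊥)))
    (h : Stable (Γ.face φ) (tmEq a (s.dinst ⊥) (L.dinst ⊥))) :
    Stable Γ (tm (.comp L φ s a) (L.dinst ⊤)) := fun _ _ _ _ ρ hr hc => by
  have ha := ha hr hc
  have h := h (hr.face φ) hc.ctx_face
  simp only [Judgment.ren, dinst_ren] at ha h ⊢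
  exact .comp (hL hr.liftDim hc.ctx_dim) (hs (hr.face φ).liftDim hc.ctx_face.ctx_dim) ha h

/-- The rule concludes in the context restricted by φ. Here φ is implied by Γ, so the restriction is
removed by `Der.of_face`. -/
theorem comp_face (hφ : Γ.restr ≤ φ) (hL : Stable Γ.dim (ty L)) (hs : Stable Γ.dim (tm s L))
    (ha : Stable Γ (tm a (L.dinst ⊥))) (h : Stable Γ (tmEq a (s.dinst ⊥) (L.dinst ⊥))) :
    Stable Γ (tmEq (.comp L φ s a) (s.dinst ⊤) (L.dinst ⊤)) := by
  intro _ _ _ _ ρ hr hc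
  have hs' : Stable (Γ.face φ).dim (tm s L) := hs.restrict (Face.subst_mono _ inf_le_left)
  have ha := ha hr hc
  have h := h.face (hr.face φ) hc.ctx_face
  simp only [Judgment.ren, dinst_ren] at ha h ⊢
  exact .of_face hc (hr.le_subst hφ) (.comp_face (hL hr.liftDim hc.ctx_dim)
    (hs' (hr.face φ).liftDim hc.ctx_face.ctx_dim) ha h)

end Comp

/-! ### The universe and glueing -/

theorem univ : Stable Γ (ty .univ) := fun _ _ _ _ _ _ hc => .univ hc

theorem el (h : Stable Γ (tm A .univ)) : Stable Γ (ty A) := fun _ _ _ _ _ hr hc =>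
  .el (h hr hc)

theorem el_congr (h : Stable Γ (tmEq A B .univ)) : Stable Γ (tyEq A B) := fun _ _ _ _ _ hr hc =>
  .el_congr (h hr hc)

theorem univ_Glue (hA : Stable Γ (tm A .univ)) (hT : Stable (Γ.face φ) (tm T .univ))
    (he : Stable (Γ.face φ) (tm e (equiv T A))) : Stable Γ (tm (.Glue φ T e A) .univ) :=
  fun _ _ _ _ _ hr hc => by
    have he := he (hr.face φ) hc.ctx_face
    simp only [Judgment.ren, equiv_ren] at he
    exact .univ_Glue (hA hr hc) (hT (hr.face φ) hc.ctx_face) he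

/-- The rule covers only the literal face `⊤`, so congruence first replaces φ by `⊤`. -/
theorem Glue_eq (hφ : Γ.restr ≤ φ) (hA : Stable Γ (tm A .univ)) (hT : Stable Γ (tm T .univ))
    (he : Stable Γ (tm e (equiv T A))) : Stable Γ (tmEq (.Glue φ T e A) T .univ) :=
  fun _ _ _ _ _ hr hc => by
    have he' := he.face (hr.face φ) hc.ctx_face
    have he := he hr hc
    simp only [Judgment.ren, equiv_ren] at he he'
    exact .tm_trans (.univ_Glue_congr (Ctx.faceEq_top (hr.le_subst hφ)) (.tm_refl (hA hr hc))
      (.tm_refl (hT.face (hr.face φ) hc.ctx_face)) (.tm_refl he'))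
      (.univ_Glue_top (hA hr hc) (hT hr hc) he)

theorem unglue (hb : Stable Γ (tm b (.Glue φ T e A))) : Stable Γ (tm (.unglue φ e b) A) :=
  fun _ _ _ _ _ hr hc => .unglue (hb hr hc)

theorem unglue_eq (hφ : Γ.restr ≤ φ) (hb : Stable Γ (tm b (.Glue φ T e A))) :
    Stable Γ (tmEq (.unglue φ e b) (.app (.fst e) b) A) :=
  fun _ _ _ _ _ hr hc => .of_face hc (hr.le_subst hφ) (.unglue_face (hb hr hc))

theorem glue (he : Stable (Γ.face φ) (tm e (equiv T A))) (ht : Stable (Γ.face φ) (tm t T))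
    (ha : Stable Γ (tm a A)) (h : Stable (Γ.face φ) (tmEq a (.app (.fst e) t) A)) :
    Stable Γ (tm (.glue φ t a) (.Glue φ T e A)) := fun _ _ _ _ _ hr hc => by
  have he := he (hr.face φ) hc.ctx_face
  simp only [Judgment.ren, equiv_ren] at he
  exact .glue he (ht (hr.face φ) hc.ctx_face) (ha hr hc) (h (hr.face φ) hc.ctx_face)

theorem glue_congr (he : Stable (Γ.face φ) (tm e (equiv T A)))
    (ht : Stable (Γ.face φ) (tmEq t t' T)) (ha : Stable Γ (tmEq a b A))
    (h : Stable (Γ.face φ) (tmEq a (.app (.fst e) t) A)) :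
    Stable Γ (tmEq (.glue φ t a) (.glue φ t' b) (.Glue φ T e A)) := fun _ _ _ _ _ hr hc => by
  have he := he (hr.face φ) hc.ctx_face
  simp only [Judgment.ren, equiv_ren] at he
  exact .glue_congr rfl he (ht (hr.face φ) hc.ctx_face) (ha hr hc) (h (hr.face φ) hc.ctx_face)

theorem glue_beta (he : Stable (Γ.face φ) (tm e (equiv T A))) (ht : Stable (Γ.face φ) (tm t T))
    (ha : Stable Γ (tm a A)) (h : Stable (Γ.face φ) (tmEq a (.app (.fst e) t) A)) :
    Stable Γ (tmEq (.unglue φ e (.glue φ t a)) a A) := fun _ _ _ _ _ hr hc => by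
  have he := he (hr.face φ) hc.ctx_face
  simp only [Judgment.ren, equiv_ren] at he
  exact .glue_beta he (ht (hr.face φ) hc.ctx_face) (ha hr hc) (h (hr.face φ) hc.ctx_face)

theorem glue_eta (hb : Stable Γ (tm b (.Glue φ T e A))) :
    Stable Γ (tmEq (.glue φ b (.unglue φ e b)) b (.Glue φ T e A)) := fun _ _ _ _ _ hr hc =>
  .tm_symm (.glue_eta (hb hr hc))

end Stable

end Rules

/-! ### Contexts of derivable judgments -/

/-- Every initial segment of the context is derivable. -/
def Ctx.Derivable : {n m : ℕ} → Ctx n m → Prop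
  | _, _, .nil => Der .nil ctx
  | _, _, .tm Γ A => Der (Γ.tm A) ctx ∧ Γ.Derivable
  | _, _, .dim Γ => Der Γ.dim ctx ∧ Γ.Derivable
  | _, _, .face Γ φ => Der (Γ.face φ) ctx ∧ Γ.Derivable

theorem Ctx.Derivable.der {n m : ℕ} {Γ : Ctx n m} (h : Γ.Derivable) : Der Γ ctx := by
  cases Γ with
  | nil => exact h
  | _ => exact h.1

/-- Needed to leave `Stable`: only a derivation of `A : U` is given, and a stable judgment can be
used in Γ only once Γ is known to be well formed. -/
theorem Der.derivable {n m : ℕ} {Γ : Ctx n m} {J : Judgment n m} (h : Der Γ J) :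
    Γ.Derivable := by
  induction h with
  | ctx_nil => exact .ctx_nil
  | ctx_tm h ih => exact ⟨.ctx_tm h, ih⟩
  | ctx_dim h ih => exact ⟨.ctx_dim h, ih⟩
  | ctx_face h ih => exact ⟨.ctx_face h, ih⟩
  | comp_face _ _ _ _ _ _ ih _ => exact ⟨.ctx_face ih.der, ih⟩
  | unglue_face _ ih => exact ⟨.ctx_face ih.der, ih⟩
  -- For each remaining rule, some premise has the very context of the conclusion.
  | _ => assumption

section Formers

variable {n n' m m' : ℕ}

/-! ### Substitution in the derived type formers -/

namespace Tm

theorem wk_subst (σ : Fin n → Tm n' m') (ρ : Fin m → Dim m') (t : Tm n m) :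
    t.wk.subst (Matrix.vecCons (var 0) fun i => (σ i).wk) ρ = (t.subst σ ρ).wk := by
  rw [wk, wk, ren_subst, subst_ren]
  exact congrArg (fun ρ' => t.subst _ ρ') (funext fun i => (Dim.subst_var _).symm)

theorem isContr_subst (σ : Fin n → Tm n' m') (ρ : Fin m → Dim m') (A : Tm n m) :
    (isContr A).subst σ ρ = isContr (A.subst σ ρ) := by
  simp only [isContr, subst, wk_subst]
  rfl

theorem fiber_subst (σ : Fin n → Tm n' m') (ρ : Fin m → Dim m') (T A f y : Tm n m) :
    (fiber T A f y).subst σ ρ =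
      fiber (T.subst σ ρ) (A.subst σ ρ) (f.subst σ ρ) (y.subst σ ρ) := by
  simp only [fiber, subst, wk_subst]
  rfl

theorem isEquiv_subst (σ : Fin n → Tm n' m') (ρ : Fin m → Dim m') (T A f : Tm n m) :
    (isEquiv T A f).subst σ ρ = isEquiv (T.subst σ ρ) (A.subst σ ρ) (f.subst σ ρ) := by
  simp only [isEquiv, isContr_subst, fiber_subst, subst, wk_subst]
  rfl

theorem equiv_subst (σ : Fin n → Tm n' m') (ρ : Fin m → Dim m') (T A : Tm n m) :
    (equiv T A).subst σ ρ = equiv (T.subst σ ρ) (A.subst σ ρ) := by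
  simp only [equiv, arrow, isEquiv_subst, subst, wk_subst]
  rfl

theorem isContr_body_inst (X c : Tm n m) :
    (pi X.wk (path X.wk.wk (var 1) (var 0))).inst c = pi X (path X.wk c.wk (var 0)) := by
  simp only [inst, subst, wk_subst]
  rw [← inst, wk_inst]
  rfl

theorem path_body_inst (X c v : Tm n m) :
    (path X.wk c.wk (var 0)).inst v = path X c v := by
  change path (X.wk.inst v) (c.wk.inst v) v = _
  rw [wk_inst, wk_inst]

theorem fiber_body_inst (A f y t : Tm n m) :
    (path A.wk y.wk (app f.wk (var 0))).inst t = path A y (app f t) := by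
  change path (A.wk.inst t) (y.wk.inst t) (app (f.wk.inst t) t) = _
  rw [wk_inst, wk_inst, wk_inst]

theorem isEquiv_body_inst (T A f y : Tm n m) :
    (isContr (fiber T.wk A.wk f.wk (var 0))).inst y = isContr (fiber T A f y) := by
  rw [inst, isContr_subst, fiber_subst, ← inst, ← inst, ← inst, wk_inst, wk_inst, wk_inst]
  rfl

theorem equiv_body_inst (T A f : Tm n m) :
    (isEquiv T.wk A.wk (var 0)).inst f = isEquiv T A f := by
  rw [inst, isEquiv_subst, ← inst, ← inst, wk_inst, wk_inst]
  rfl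

theorem equiv_var_inst (A T : Tm n m) : (equiv (var 0) A.wk).inst T = equiv T A := by
  rw [inst, equiv_subst]
  exact congrArg (equiv T) (wk_inst A T)

/-- Weakening under the binder followed by instantiation at the fresh variable is the identity. This
appears when β is applied after η-expanding an abstraction; `ren_liftDim_dinst` is the analogue for
path abstractions. -/
theorem ren_liftVar_inst (t : Tm (n + 1) m) :
    (t.ren (liftVar Fin.succ) Dim.var).inst (var 0) = t := by
  rw [inst, ren_subst]
  refine Eq.trans ?_ t.subst_var
  congr 1
  funext i
  refine Fin.cases rfl (fun _ => rfl) i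

theorem ren_liftDim_dinst (t : Tm n (m + 1)) :
    (t.ren (fun i => i) (liftDim fun i => .var i.succ)).dinst (.var 0) = t := by
  rw [dinst, dsubst, ren_ren]
  refine Eq.trans ?_ t.ren_id
  congr 1
  funext i
  refine Fin.cases rfl (fun _ => rfl) i

end Tm

theorem Dim.wk_inst (r s : Dim m) : r.wk.subst (Matrix.vecCons s Dim.var) = r := by
  rw [Dim.wk, Dim.subst_subst]
  exact r.subst_var

/-! ### Typing of the derived type formers -/

namespace Stable

variable {Γ : Ctx n m} {A B T T' X X' f f' e t t' u u' y a b c p v : Tm n m} {g : Tm (n + 1) m}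
  {φ ψ : Face m}

theorem cast (h : Stable Γ (tm t A)) (hA : A = B) : Stable Γ (tm t B) := hA ▸ h

theorem castEq (h : Stable Γ (tmEq t u A)) (hA : A = B) : Stable Γ (tmEq t u B) := hA ▸ h

theorem arrow_ty (hA : Stable Γ (ty A)) (hB : Stable Γ (ty B)) : Stable Γ (ty (arrow A B)) :=
  hA.pi hB.wk

theorem arrow_app (hf : Stable Γ (tm f (arrow T A))) (hu : Stable Γ (tm u T)) :
    Stable Γ (tm (.app f u) A) :=
  (hf.app hu).cast (wk_inst A u)

theorem arrow_app_congr (hf : Stable Γ (tmEq f f' (arrow T A))) (hu : Stable Γ (tmEq u u' T)) :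
    Stable Γ (tmEq (.app f u) (.app f' u') A) :=
  (hf.app_congr hu).castEq (wk_inst A u)

theorem fiber_body_ty (hA : Stable Γ (ty A)) (hf : Stable Γ (tm f (arrow T A)))
    (hy : Stable Γ (tm y A)) :
    Stable (Γ.tm T) (ty (.path A.wk y.wk (.app f.wk (.var 0)))) :=
  .path hA.wk hy.wk (.arrow_app (hf.wk.cast (arrow_ren _ _ _ _)) .var_zero)

theorem fiber_ty (hT : Stable Γ (ty T)) (hA : Stable Γ (ty A))
    (hf : Stable Γ (tm f (arrow T A))) (hy : Stable Γ (tm y A)) :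
    Stable Γ (ty (fiber T A f y)) :=
  hT.sigma (fiber_body_ty hA hf hy)

theorem fiber_congr (hT : Stable Γ (ty T)) (hT' : Stable Γ (tyEq T T')) (hA : Stable Γ (ty A))
    (hf : Stable Γ (tmEq f f' (arrow T A))) (hy : Stable Γ (tm y A)) :
    Stable Γ (tyEq (fiber T A f y) (fiber T' A f' y)) :=
  hT.sigma_congr hT' (.path_congr hA.wk.ty_refl hy.wk.refl
    (.arrow_app_congr (hf.wk.castEq (arrow_ren _ _ _ _)) var_zero.refl))

theorem isContr_body_ty (hX : Stable Γ (ty X)) :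
    Stable (Γ.tm X) (ty (.pi X.wk (.path X.wk.wk (.var 1) (.var 0)))) :=
  .pi hX.wk (.path hX.wk.wk (var_zero (Γ := Γ) (A := X)).wk .var_zero)

theorem isContr_ty (hX : Stable Γ (ty X)) : Stable Γ (ty (isContr X)) :=
  hX.sigma hX.isContr_body_ty

theorem isContr_congr (hX : Stable Γ (ty X)) (h : Stable Γ (tyEq X X')) :
    Stable Γ (tyEq (isContr X) (isContr X')) :=
  hX.sigma_congr h (.pi_congr hX.wk h.wk (.path_congr h.wk.wk
    (var_zero (Γ := Γ) (A := X)).wk.refl var_zero.refl))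

theorem isContr_fst (hp : Stable Γ (tm p (isContr X))) : Stable Γ (tm (.fst p) X) := hp.fst

theorem isContr_snd (hp : Stable Γ (tm p (isContr X))) :
    Stable Γ (tm (.snd p) (.pi X (.path X.wk (Tm.fst p).wk (.var 0)))) :=
  hp.snd.cast (isContr_body_inst _ _)

theorem isContr_path (hp : Stable Γ (tm p (isContr X))) (hv : Stable Γ (tm v X)) :
    Stable Γ (tm (.app (.snd p) v) (.path X (.fst p) v)) :=
  (hp.isContr_snd.app hv).cast (path_body_inst _ _ _)

theorem isContr_intro (hX : Stable Γ (ty X)) (hc : Stable Γ (tm c X))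
    (hg : Stable (Γ.tm X) (tm g (.path X.wk c.wk (.var 0)))) :
    Stable Γ (tm (.pair c (.lam X g)) (isContr X)) :=
  hX.pair hX.isContr_body_ty hc ((hX.lam hg).cast (isContr_body_inst _ _).symm)

/-- An abstraction is equal to a function with the same values. -/
theorem lam_eq {P : Tm (n + 1) m} (hX : Stable Γ (ty X)) (hg : Stable (Γ.tm X) (tm g P))
    (hf : Stable Γ (tm f (.pi X P)))
    (h : Stable (Γ.tm X) (tmEq g (.app f.wk (.var 0)) P)) :
    Stable Γ (tmEq (.lam X g) f (.pi X P)) := by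
  refine hX.pi_eta (hX.lam hg) hf (.trans ?_ h)
  have := pi_beta (Γ := Γ.tm X) hX.wk (hg.ren ((Ctx.Ren.succ Γ X).liftTm X)) var_zero
  rw [ren_liftVar_inst, ren_liftVar_inst] at this
  exact this

/-- By surjective pairing and η for functions it suffices to compare the centres and the paths to a
generic point. -/
theorem isContr_eq (hX : Stable Γ (ty X)) (hc : Stable Γ (tmEq c (.fst p) X))
    (hg : Stable (Γ.tm X) (tm g (.path X.wk c.wk (.var 0))))
    (hp : Stable Γ (tm p (isContr X)))
    (h : Stable (Γ.tm X) (tmEq g (.app (Tm.snd p).wk (.var 0)) (.path X.wk c.wk (.var 0)))) :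
    Stable Γ (tmEq (.pair c (.lam X g)) p (isContr X)) := by
  refine (hX.pair_congr hX.isContr_body_ty hc (.castEq ?_ (isContr_body_inst _ _).symm)).trans
    (hX.pair_eta hX.isContr_body_ty hp)
  -- The paths of `p` start at `p.1` and those of `g` at `c`, so `p.2` is first converted along `c =
  -- p.1`.
  exact hX.lam_eq hg (hp.isContr_snd.conv (hX.pi_congr hX.ty_refl
    (.path_congr hX.wk.ty_refl hc.symm.wk var_zero.refl))) h

theorem isEquiv_body_ty (hT : Stable Γ (ty T)) (hA : Stable Γ (ty A))
    (hf : Stable Γ (tm f (arrow T A))) :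
    Stable (Γ.tm A) (ty (isContr (fiber T.wk A.wk f.wk (.var 0)))) :=
  (fiber_ty hT.wk hA.wk (hf.wk.cast (arrow_ren _ _ _ _)) .var_zero).isContr_ty

theorem isEquiv_ty (hT : Stable Γ (ty T)) (hA : Stable Γ (ty A))
    (hf : Stable Γ (tm f (arrow T A))) : Stable Γ (ty (isEquiv T A f)) :=
  hA.pi (isEquiv_body_ty hT hA hf)

theorem isEquiv_congr (hT : Stable Γ (ty T)) (hT' : Stable Γ (tyEq T T'))
    (hA : Stable Γ (ty A)) (hf : Stable Γ (tm f (arrow T A)))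
    (hf' : Stable Γ (tmEq f f' (arrow T A))) :
    Stable Γ (tyEq (isEquiv T A f) (isEquiv T' A f')) :=
  hA.pi_congr hA.ty_refl ((fiber_ty hT.wk hA.wk (hf.wk.cast (arrow_ren _ _ _ _))
    .var_zero).isContr_congr (fiber_congr hT.wk hT'.wk hA.wk
      (hf'.wk.castEq (arrow_ren _ _ _ _)) .var_zero))

theorem equiv_body_ty (hT : Stable Γ (ty T)) (hA : Stable Γ (ty A)) :
    Stable (Γ.tm (arrow T A)) (ty (isEquiv T.wk A.wk (.var 0))) :=
  isEquiv_ty hT.wk hA.wk (var_zero.cast (arrow_ren _ _ _ _))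

theorem equiv_ty (hT : Stable Γ (ty T)) (hA : Stable Γ (ty A)) :
    Stable Γ (ty (equiv T A)) :=
  (hT.arrow_ty hA).sigma (hT.equiv_body_ty hA)

theorem arrow_congr (hT : Stable Γ (ty T)) (hT' : Stable Γ (tyEq T T')) (hA : Stable Γ (ty A)) :
    Stable Γ (tyEq (arrow T A) (arrow T' A)) :=
  hT.pi_congr hT' hA.wk.ty_refl

theorem equiv_congr (hT : Stable Γ (ty T)) (hT' : Stable Γ (tyEq T T')) (hA : Stable Γ (ty A)) :
    Stable Γ (tyEq (equiv T A) (equiv T' A)) :=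
  (hT.arrow_ty hA).sigma_congr (hT.arrow_congr hT' hA)
    (isEquiv_congr hT.wk hT'.wk hA.wk (var_zero.cast (arrow_ren _ _ _ _))
      (var_zero.refl.castEq (arrow_ren _ _ _ _)))

theorem equiv_fst (he : Stable Γ (tm e (equiv T A))) : Stable Γ (tm (.fst e) (arrow T A)) :=
  he.fst

theorem equiv_snd (he : Stable Γ (tm e (equiv T A))) :
    Stable Γ (tm (.snd e) (isEquiv T A (.fst e))) :=
  he.snd.cast (equiv_body_inst _ _ _)

theorem equiv_contr (he : Stable Γ (tm e (equiv T A))) (ha : Stable Γ (tm a A)) :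
    Stable Γ (tm (.app (.snd e) a) (isContr (fiber T A (.fst e) a))) :=
  (he.equiv_snd.app ha).cast (isEquiv_body_inst _ _ _ _)

/-! ### Lines with prescribed end points -/

section Lines

variable {q : Tm n (m + 1)}

/-- Substituting `0` for `i` turns the face `(i = 0)` into `⊤`, so an end point of a line can be
computed on that face before substituting. -/
theorem dinst_zero (h : Stable (Γ.dim.face (Face.eq0 0)) (tmEq q a.wkD A.wkD)) :
    Stable Γ (tmEq (q.dinst ⊥) a A) := by
  have h := h.ren (Δ := Γ) (ξ := fun i => i) (ρ := Matrix.vecCons ⊥ Dim.var)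
    ⟨(Ctx.Ren.inst Γ ⊥).lookup, ?_⟩
  · change Stable Γ (tmEq (q.dinst ⊥) (a.wkD.dinst ⊥) (A.wkD.dinst ⊥)) at h
    rwa [wkD_dinst, wkD_dinst] at h
  · change _ ≤ (Γ.dim.restr ⊓ Face.eq0 0).subst _
    rw [Face.subst_inf]
    exact le_inf (Ctx.Ren.inst Γ ⊥).restr le_top

theorem dinst_one (h : Stable (Γ.dim.face (Face.eq1 0)) (tmEq q a.wkD A.wkD)) :
    Stable Γ (tmEq (q.dinst ⊤) a A) := by
  have h := h.ren (Δ := Γ) (ξ := fun i => i) (ρ := Matrix.vecCons ⊤ Dim.var)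
    ⟨(Ctx.Ren.inst Γ ⊤).lookup, ?_⟩
  · change Stable Γ (tmEq (q.dinst ⊤) (a.wkD.dinst ⊤) (A.wkD.dinst ⊤)) at h
    rwa [wkD_dinst, wkD_dinst] at h
  · change _ ≤ (Γ.dim.restr ⊓ Face.eq1 0).subst _
    rw [Face.subst_inf]
    exact le_inf (Ctx.Ren.inst Γ ⊤).restr le_top

end Lines

/-! ### Binary systems -/

/-- Only the mixed overlap has to be checked; the diagonal ones are reflexivity. -/
theorem sys_two (hA : Stable Γ (ty A)) (hφ : Γ.restr ≤ φ ⊔ ψ)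
    (ht : Stable (Γ.face φ) (tm t A)) (hu : Stable (Γ.face ψ) (tm u A))
    (h : Stable (Γ.face (φ ⊓ ψ)) (tmEq t u A)) :
    Stable Γ (tm (.sys 2 ![φ, ψ] ![t, u]) A) := by
  refine hA.sys (hφ.trans (sup_le (Finset.le_sup (f := ![φ, ψ]) (Finset.mem_univ 0))
    (Finset.le_sup (f := ![φ, ψ]) (Finset.mem_univ 1)))) ?_ ?_
  · exact Fin.forall_fin_two.2 ⟨ht, hu⟩
  · refine Fin.forall_fin_two.2 ⟨Fin.forall_fin_two.2 ⟨?_, h⟩, Fin.forall_fin_two.2 ⟨?_, ?_⟩⟩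
    · exact ht.refl.restrict (inf_le_inf_left _ inf_le_left)
    · exact h.symm.restrict (inf_le_inf_left _ (inf_comm _ _).le)
    · exact hu.refl.restrict (inf_le_inf_left _ inf_le_left)

end Stable

end Formers

section Glueing

variable {n n' m m' : ℕ}

/-! ### Extending a path along its initial point -/

/-- `compʲ A [φ ↦ p (r ∧ j), (r = 0) ↦ a] a`. -/
def Tm.pathComp (A : Tm n m) (φ : Face m) (p a : Tm n m) (r : Dim m) : Tm n m :=
  comp A.wkD (φ ⊔ r.isZero)
    (sys 2 ![φ.wk, r.isZero.wk] ![papp p.wkD (r.wk ⊓ Dim.var 0), a.wkD]) a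

namespace Stable

variable {Γ : Ctx n m} {A a b p : Tm n m} {φ : Face m} {r : Dim m}

/-- The path `p`, and with it the end point `b`, need only make sense on φ. The two parts of the
system agree on the overlap because `r = 0` forces `r ∧ j = 0`, where `p` takes the value `a`. -/
theorem pathComp_sys (hA : Stable Γ (ty A)) (ha : Stable Γ (tm a A))
    (hp : Stable (Γ.face φ) (tm p (.path A a b))) :
    Stable (Γ.face (φ ⊔ r.isZero)).dim (tm (.sys 2 ![φ.wk, r.isZero.wk]
      ![.papp p.wkD (r.wk ⊓ Dim.var 0), a.wkD]) A.wkD) := by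
  have hp' : Stable (((Γ.face (φ ⊔ r.isZero)).dim).face φ.wk)
      (tm p.wkD (.path A.wkD a.wkD b.wkD)) := by
    refine hp.wkD.restrict ?_
    simp only [Ctx.restr, Face.wk, Face.subst_inf]
    exact inf_le_inf_right _ inf_le_left
  refine hA.face.wkD.sys_two ?_ (hp'.papp _) ha.face.wkD.face ?_
  · simp only [Ctx.restr, Face.wk, Face.subst_inf, Face.subst_sup]
    exact inf_le_right
  · refine (hp'.restrict (inf_le_inf_left _ inf_le_left)).papp_isZero ?_
    refine inf_le_right.trans (inf_le_right.trans ?_)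
    rw [Dim.isZero_inf, Dim.wk, Dim.isZero_subst]
    exact le_sup_left

/-- Used with `s = 0`, where `p (r ∧ 0) = a` is the base of the composition, and with `s = 1`, where
`p (r ∧ 1) = p r` is its value. -/
theorem pathComp_sys_dinst (s : Dim m) (hφ : Γ.restr ≤ φ) (hA : Stable Γ (ty A))
    (ha : Stable Γ (tm a A)) (hp : Stable (Γ.face φ) (tm p (.path A a b))) :
    Stable Γ (tmEq ((Tm.sys 2 ![φ.wk, r.isZero.wk]
      ![.papp p.wkD (r.wk ⊓ Dim.var 0), a.wkD]).dinst s) (.papp p (r ⊓ s)) A) := by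
  have h := ((pathComp_sys (r := r) hA ha hp).dinst s).restrict (Δ := Γ)
    (le_inf le_rfl (hφ.trans le_sup_left))
  have h := h.sys_eq 0 (hφ.trans (le_of_eq ?_))
  · change Stable Γ (tmEq _ (.papp (p.wkD.dinst s)
      ((r.wk ⊓ Dim.var 0).subst (Matrix.vecCons s Dim.var))) (A.wkD.dinst s)) at h
    rw [wkD_dinst, wkD_dinst, Dim.subst_inf, Dim.wk_inst] at h
    exact h
  · change _ = φ.wk.subst _
    rw [Face.wk, Face.subst_subst]
    exact φ.subst_var.symm

theorem pathComp_sys_dinst_zero (s : Dim m) (hr : Γ.restr ≤ r.isZero) (hA : Stable Γ (ty A))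
    (ha : Stable Γ (tm a A)) (hp : Stable (Γ.face φ) (tm p (.path A a b))) :
    Stable Γ (tmEq ((Tm.sys 2 ![φ.wk, r.isZero.wk]
      ![.papp p.wkD (r.wk ⊓ Dim.var 0), a.wkD]).dinst s) a A) := by
  have h := ((pathComp_sys (r := r) hA ha hp).dinst s).restrict (Δ := Γ)
    (le_inf le_rfl (hr.trans le_sup_right))
  have h := h.sys_eq 1 (hr.trans (le_of_eq ?_))
  · change Stable Γ (tmEq _ (a.wkD.dinst s) (A.wkD.dinst s)) at h
    rw [wkD_dinst, wkD_dinst] at h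
    exact h
  · change _ = r.isZero.wk.subst _
    rw [Face.wk, Face.subst_subst]
    exact r.isZero.subst_var.symm

theorem pathComp_start (hA : Stable Γ (ty A)) (ha : Stable Γ (tm a A))
    (hp : Stable (Γ.face φ) (tm p (.path A a b))) :
    Stable (Γ.face (φ ⊔ r.isZero)) (tmEq a ((Tm.sys 2 ![φ.wk, r.isZero.wk]
      ![.papp p.wkD (r.wk ⊓ Dim.var 0), a.wkD]).dinst ⊥) A) := by
  refine .cover (φ := φ) (ψ := r.isZero) inf_le_right ?_ ?_
  -- The face φ occurs twice, as a restriction of the context and as the domain of `p`.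
  · have hp' := hp.restrict (Δ := ((Γ.face (φ ⊔ r.isZero)).face φ).face φ)
      (inf_le_inf_right _ (inf_le_left.trans inf_le_left))
    have hp'' := hp'.restrict (Δ := (Γ.face (φ ⊔ r.isZero)).face φ) (le_inf le_rfl inf_le_right)
    refine .symm ((pathComp_sys_dinst ⊥ inf_le_right hA.face.face ha.face.face hp').trans
      (hp''.papp_isZero ?_))
    rw [inf_bot_eq]
    exact le_top
  · exact (pathComp_sys_dinst_zero ⊥ inf_le_right hA.face.face ha.face.face
      (hp.restrict (inf_le_inf_right _ (inf_le_left.trans inf_le_left)))).symm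

theorem pathComp (hA : Stable Γ (ty A)) (ha : Stable Γ (tm a A))
    (hp : Stable (Γ.face φ) (tm p (.path A a b))) :
    Stable Γ (tm (Tm.pathComp A φ p a r) A) := by
  refine (comp hA.wkD (pathComp_sys hA ha hp) (ha.cast (wkD_dinst _ _).symm)
    ((pathComp_start hA ha hp).castEq (wkD_dinst _ _).symm)).cast (wkD_dinst _ _)

theorem pathComp_face (hφ : Γ.restr ≤ φ ⊔ r.isZero) (hA : Stable Γ (ty A))
    (ha : Stable Γ (tm a A)) (hp : Stable (Γ.face φ) (tm p (.path A a b))) :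
    Stable Γ (tmEq (Tm.pathComp A φ p a r) ((Tm.sys 2 ![φ.wk, r.isZero.wk]
      ![.papp p.wkD (r.wk ⊓ Dim.var 0), a.wkD]).dinst ⊤) A) := by
  refine (comp_face hφ hA.wkD ((pathComp_sys hA ha hp).restrict ?_)
    (ha.cast (wkD_dinst _ _).symm) (((pathComp_start hA ha hp).restrict
      (le_inf le_rfl hφ)).castEq (wkD_dinst _ _).symm)).castEq (wkD_dinst _ _)
  exact Face.subst_mono _ (le_inf le_rfl hφ)

theorem pathComp_eq (hφ : Γ.restr ≤ φ) (hA : Stable Γ (ty A))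
    (ha : Stable Γ (tm a A)) (hp : Stable (Γ.face φ) (tm p (.path A a b))) :
    Stable Γ (tmEq (Tm.pathComp A φ p a r) (.papp p r) A) := by
  have h := pathComp_sys_dinst (r := r) ⊤ hφ hA ha hp
  rw [inf_top_eq] at h
  exact (pathComp_face (hφ.trans le_sup_left) hA ha hp).trans h

theorem pathComp_eq_start (hr : Γ.restr ≤ r.isZero) (hA : Stable Γ (ty A))
    (ha : Stable Γ (tm a A)) (hp : Stable (Γ.face φ) (tm p (.path A a b))) :
    Stable Γ (tmEq (Tm.pathComp A φ p a r) a A) :=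
  (pathComp_face (hr.trans le_sup_right) hA ha hp).trans
    (pathComp_sys_dinst_zero ⊤ hr hA ha hp)

end Stable

/-- `pathComp` along a new name. -/
def Tm.pathFill (A : Tm n m) (φ : Face m) (p a : Tm n m) : Tm n (m + 1) :=
  pathComp A.wkD φ.wk p.wkD a.wkD (.var 0)

namespace Stable

variable {Γ : Ctx n m} {A a b p : Tm n m} {φ : Face m}

theorem pathFill (hA : Stable Γ (ty A)) (ha : Stable Γ (tm a A))
    (hp : Stable (Γ.face φ) (tm p (.path A a b))) :
    Stable Γ.dim (tm (Tm.pathFill A φ p a) A.wkD) := by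
  refine hA.wkD.pathComp (b := b.wkD) ha.wkD (hp.wkD.restrict ?_)
  simp only [Ctx.restr, Face.wk, Face.subst_inf, le_refl]

theorem pathFill_eq (hφ : Γ.restr ≤ φ) (hA : Stable Γ (ty A)) (ha : Stable Γ (tm a A))
    (hp : Stable (Γ.face φ) (tm p (.path A a b))) :
    Stable Γ.dim (tmEq (Tm.pathFill A φ p a) (.papp p.wkD (.var 0)) A.wkD) := by
  refine pathComp_eq (b := b.wkD) (Face.subst_mono _ hφ) hA.wkD ha.wkD (hp.wkD.restrict ?_)
  simp only [Ctx.restr, Face.wk, Face.subst_inf, le_refl]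

/-- With `r` the new name `i`, the part of the system on `(r = 0)` pins the line to `a` at its
start, also off φ. -/
theorem pathFill_zero (hA : Stable Γ (ty A)) (ha : Stable Γ (tm a A))
    (hp : Stable (Γ.face φ) (tm p (.path A a b))) :
    Stable Γ (tmEq ((Tm.pathFill A φ p a).dinst ⊥) a A) := by
  have h : Stable (Γ.dim.face (Face.eq0 0)) (tmEq (Tm.pathFill A φ p a) a.wkD A.wkD) := by
    refine pathComp_eq_start (b := b.wkD) inf_le_right hA.wkD.face ha.wkD.face
      (hp.wkD.restrict ?_)
    simp only [Ctx.restr, Face.wk, Face.subst_inf]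
    exact inf_le_inf_right _ inf_le_left
  exact h.dinst_zero

theorem pathFill_one (hA : Stable Γ (ty A)) (ha : Stable Γ (tm a A))
    (hp : Stable (Γ.face φ) (tm p (.path A a b))) :
    Stable Γ (tm ((Tm.pathFill A φ p a).dinst ⊤) A) :=
  ((hA.pathFill ha hp).dinst ⊤).cast (wkD_dinst _ _)

theorem pathFill_one_eq (hφ : Γ.restr ≤ φ) (hA : Stable Γ (ty A)) (ha : Stable Γ (tm a A))
    (hp : Stable (Γ.face φ) (tm p (.path A a b))) :
    Stable Γ (tmEq ((Tm.pathFill A φ p a).dinst ⊤) b A) := by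
  have h : Stable Γ (tmEq _ (.papp (p.wkD.dinst ⊤) ⊤) (A.wkD.dinst ⊤)) :=
    (pathFill_eq hφ hA ha hp).dinst ⊤
  rw [wkD_dinst, wkD_dinst] at h
  exact h.trans ((hp.restrict (le_inf le_rfl hφ)).papp_isOne le_top)

/-- The path from `a` given by `pathFill`. -/
theorem plam_pathFill (hA : Stable Γ (ty A)) (ha : Stable Γ (tm a A))
    (hp : Stable (Γ.face φ) (tm p (.path A a b)))
    {c : Tm n m} (hc : Stable Γ (tmEq ((Tm.pathFill A φ p a).dinst ⊤) c A)) :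
    Stable Γ (tm (.plam (Tm.pathFill A φ p a)) (.path A a c)) :=
  hA.plam (hA.pathFill ha hp) (hA.pathFill_zero ha hp) hc

end Stable

end Glueing

section Glueing

variable {n n' m m' : ℕ}

/-! ### The map `unglue` and its fibers -/

/-- `unglue` as a function from `Glue [φ ↦ (T, e)] A` to `A`. -/
def Tm.unglueMap (φ : Face m) (T e A : Tm n m) : Tm n m :=
  lam (Glue φ T e A) (unglue φ e.wk (var 0))

/-- The fiber of `unglue` over `a`. -/
def Tm.glueFiber (φ : Face m) (T e A a : Tm n m) : Tm n m :=
  fiber (Glue φ T e A) A (unglueMap φ T e A) a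

theorem Tm.unglueMap_ren (ξ : Fin n → Fin n') (ρ : Fin m → Dim m') (φ : Face m)
    (T e A : Tm n m) : (unglueMap φ T e A).ren ξ ρ =
      unglueMap (φ.subst ρ) (T.ren ξ ρ) (e.ren ξ ρ) (A.ren ξ ρ) := by
  simp [unglueMap]

theorem Tm.glueFiber_ren (ξ : Fin n → Fin n') (ρ : Fin m → Dim m') (φ : Face m)
    (T e A a : Tm n m) : (glueFiber φ T e A a).ren ξ ρ =
      glueFiber (φ.subst ρ) (T.ren ξ ρ) (e.ren ξ ρ) (A.ren ξ ρ) (a.ren ξ ρ) := by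
  simp [glueFiber, fiber_ren, unglueMap_ren]

theorem Tm.glueFiber_wk (φ : Face m) (T e A a : Tm n m) :
    (glueFiber φ T e A a).wk = glueFiber φ T.wk e.wk A.wk a.wk := by
  rw [wk, glueFiber_ren, Face.subst_var]
  rfl

theorem Tm.glueFiber_wkD (φ : Face m) (T e A a : Tm n m) :
    (glueFiber φ T e A a).wkD = glueFiber φ.wk T.wkD e.wkD A.wkD a.wkD :=
  glueFiber_ren _ _ _ _ _ _ _

/-- The data for forming `Glue [φ ↦ (T, e)] A` in the universe. -/
structure GlueData (Γ : Ctx n m) (φ : Face m) (T e A : Tm n m) : Prop where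
  base : Stable Γ (tm A .univ)
  cover : Stable (Γ.face φ) (tm T .univ)
  equiv : Stable (Γ.face φ) (tm e (equiv T A))

namespace GlueData

variable {Γ : Ctx n m} {φ : Face m} {T e A a b c u w : Tm n m}

theorem ren {Δ : Ctx n' m'} {ξ ρ} (h : GlueData Γ φ T e A) (hr : Γ.Ren Δ ξ ρ) :
    GlueData Δ (φ.subst ρ) (T.ren ξ ρ) (e.ren ξ ρ) (A.ren ξ ρ) where
  base := h.base.ren hr
  cover := h.cover.ren (hr.face φ)
  equiv := (h.equiv.ren (hr.face φ)).cast (equiv_ren _ _ _ _)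

theorem wk {B : Tm n m} (h : GlueData Γ φ T e A) :
    GlueData (Γ.tm B) φ T.wk e.wk A.wk := by
  have := h.ren (.succ Γ B)
  rwa [Face.subst_var] at this

theorem wkD (h : GlueData Γ φ T e A) : GlueData Γ.dim φ.wk T.wkD e.wkD A.wkD :=
  h.ren (.succDim Γ)

theorem restrict {Δ : Ctx n m} (h : GlueData Γ φ T e A) (hr : Δ.restr ≤ Γ.restr)
    (hl : ∀ x, Δ.lookup x = Γ.lookup x := by exact fun _ => rfl) : GlueData Δ φ T e A where
  base := h.base.restrict hr hl
  cover := h.cover.restrict (inf_le_inf_right _ hr) hl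
  equiv := h.equiv.restrict (inf_le_inf_right _ hr) hl

theorem face {ψ : Face m} (h : GlueData Γ φ T e A) : GlueData (Γ.face ψ) φ T e A :=
  h.restrict inf_le_left

theorem glue_univ (h : GlueData Γ φ T e A) : Stable Γ (tm (.Glue φ T e A) .univ) :=
  h.base.univ_Glue h.cover h.equiv

theorem glue_eq (hφ : Γ.restr ≤ φ) (h : GlueData Γ φ T e A) :
    Stable Γ (tmEq (.Glue φ T e A) T .univ) :=
  .Glue_eq hφ h.base (h.cover.restrict (le_inf le_rfl hφ)) (h.equiv.restrict (le_inf le_rfl hφ))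

theorem unglueMap (h : GlueData Γ φ T e A) :
    Stable Γ (tm (Tm.unglueMap φ T e A) (arrow (.Glue φ T e A) A)) := by
  refine h.glue_univ.el.lam (.unglue (T := T.wk) (Stable.var_zero.cast ?_))
  rw [Tm.wk, Tm.ren, Face.subst_var]
  rfl

theorem unglueMap_app (h : GlueData Γ φ T e A) (hb : Stable Γ (tm b (.Glue φ T e A))) :
    Stable Γ (tmEq (.app (Tm.unglueMap φ T e A) b) (.unglue φ e b) A) := by
  have h' : Stable (Γ.tm (.Glue φ T e A)) (tm (.unglue φ e.wk (.var 0)) A.wk) := by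
    refine .unglue (T := T.wk) (Stable.var_zero.cast ?_)
    rw [Tm.wk, Tm.ren, Face.subst_var]
    rfl
  have := h.glue_univ.el.pi_beta h' hb
  rw [wk_inst] at this
  change Stable Γ (tmEq _ (.unglue (φ.subst Dim.var) (e.wk.inst b) b) A) at this
  rwa [wk_inst, Face.subst_var] at this

/-- On φ the type `Glue` is `T` and `unglue b` is `e.1 b`, so the two functions agree by η. -/
theorem unglueMap_eq (hφ : Γ.restr ≤ φ) (h : GlueData Γ φ T e A) :
    Stable Γ (tmEq (Tm.unglueMap φ T e A) (.fst e) (arrow (.Glue φ T e A) A)) := by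
  have hb : Stable (Γ.tm (.Glue φ T e A)) (tm (.var 0) (.Glue φ T.wk e.wk A.wk)) := by
    refine Stable.var_zero.cast ?_
    rw [Tm.wk, Tm.ren, Face.subst_var]
    rfl
  have he : Stable Γ (tm e (.equiv T A)) := h.equiv.restrict (le_inf le_rfl hφ)
  refine h.glue_univ.el.lam_eq hb.unglue (he.equiv_fst.conv ?_) (hb.unglue_eq hφ)
  exact (h.cover.restrict (le_inf le_rfl hφ)).el.arrow_congr (h.glue_eq hφ).symm.el_congr
    h.base.el

theorem fiber_body_ty (h : GlueData Γ φ T e A) (ha : Stable Γ (tm a A)) :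
    Stable (Γ.tm (.Glue φ T e A))
      (ty (.path A.wk a.wk (.app (Tm.unglueMap φ T e A).wk (.var 0)))) :=
  .fiber_body_ty h.base.el h.unglueMap ha

theorem fiber_ty (h : GlueData Γ φ T e A) (ha : Stable Γ (tm a A)) :
    Stable Γ (ty (glueFiber φ T e A a)) :=
  .fiber_ty h.glue_univ.el h.base.el h.unglueMap ha

/-- This is what lets `e.2` act as a partial proof that the fibers of `unglue` are contractible. -/
theorem fiber_eq (hφ : Γ.restr ≤ φ) (h : GlueData Γ φ T e A) (ha : Stable Γ (tm a A)) :
    Stable Γ (tyEq (glueFiber φ T e A a) (fiber T A (.fst e) a)) :=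
  .fiber_congr h.glue_univ.el (h.glue_eq hφ).el_congr h.base.el (h.unglueMap_eq hφ) ha

theorem fiber_snd (hw : Stable Γ (tm w (glueFiber φ T e A a))) :
    Stable Γ (tm (.snd w) (.path A a (.app (Tm.unglueMap φ T e A) (.fst w)))) :=
  hw.snd.cast (fiber_body_inst _ _ _ _)

end GlueData

/-! ### Extending partial elements of the fibers of `unglue` -/

/-- The extension to the whole context of an element `w` of the fiber of `unglue` over `a`,
defined on a face `ψ` that contains `φ`. -/
def Tm.fiberExt (φ : Face m) (A : Tm n m) (ψ : Face m) (w a : Tm n m) : Tm n m :=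
  pair (glue φ (fst w) ((pathFill A ψ (snd w) a).dinst ⊤)) (plam (pathFill A ψ (snd w) a))

namespace GlueData

variable {Γ : Ctx n m} {φ ψ : Face m} {T e A a b c u w : Tm n m}

/-- Where ψ holds, the extended path is `w.2`, which ends at `unglue` of `w.1`. -/
theorem fiberExt_base_eq (hψ : Γ.restr ≤ ψ) (h : GlueData Γ φ T e A) (ha : Stable Γ (tm a A))
    (hw : Stable (Γ.face ψ) (tm w (glueFiber φ T e A a))) :
    Stable Γ (tmEq ((Tm.pathFill A ψ (.snd w) a).dinst ⊤) (.unglue φ e (.fst w)) A) :=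
  (h.base.el.pathFill_one_eq hψ ha (fiber_snd hw)).trans
    (h.unglueMap_app (hw.restrict (le_inf le_rfl hψ)).fst)

theorem fiberExt_cover (hφψ : φ ≤ ψ) (h : GlueData Γ φ T e A)
    (hw : Stable (Γ.face ψ) (tm w (glueFiber φ T e A a))) :
    Stable (Γ.face φ) (tm (.fst w) T) :=
  (hw.restrict (inf_le_inf_left _ hφψ)).fst.conv
    ((h.face (ψ := φ)).glue_eq inf_le_right).el_congr

theorem fiberExt_cover_eq (hφψ : φ ≤ ψ) (h : GlueData Γ φ T e A) (ha : Stable Γ (tm a A))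
    (hw : Stable (Γ.face ψ) (tm w (glueFiber φ T e A a))) :
    Stable (Γ.face φ) (tmEq ((Tm.pathFill A ψ (.snd w) a).dinst ⊤)
      (.app (.fst e) (.fst w)) A) :=
  (h.face.fiberExt_base_eq (inf_le_right.trans hφψ) ha.face
      (hw.restrict (inf_le_inf_right _ inf_le_left))).trans
    (Stable.unglue_eq inf_le_right (hw.restrict (inf_le_inf_left _ hφψ)).fst)

/-- Glueing needs a point of `T` on φ, and φ ≤ ψ makes `w.1` available there. The end of the
extended path lies over it, since on φ `unglue` is `e.1`. -/
theorem fiberExt_fst (hφψ : φ ≤ ψ) (h : GlueData Γ φ T e A) (ha : Stable Γ (tm a A))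
    (hw : Stable (Γ.face ψ) (tm w (glueFiber φ T e A a))) :
    Stable Γ (tm (.glue φ (.fst w) ((Tm.pathFill A ψ (.snd w) a).dinst ⊤)) (.Glue φ T e A)) :=
  .glue h.equiv (h.fiberExt_cover hφψ hw) (h.base.el.pathFill_one ha (fiber_snd hw))
    (h.fiberExt_cover_eq hφψ ha hw)

/-- By β for glueing, `unglue` sends the glued point to the end of the extended path. -/
theorem fiberExt_snd (hφψ : φ ≤ ψ) (h : GlueData Γ φ T e A) (ha : Stable Γ (tm a A))
    (hw : Stable (Γ.face ψ) (tm w (glueFiber φ T e A a))) :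
    Stable Γ (tm (.plam (Tm.pathFill A ψ (.snd w) a)) (.path A a
      (.app (Tm.unglueMap φ T e A)
        (.glue φ (.fst w) ((Tm.pathFill A ψ (.snd w) a).dinst ⊤))))) :=
  h.base.el.plam_pathFill ha (fiber_snd hw) (.symm
    ((h.unglueMap_app (h.fiberExt_fst hφψ ha hw)).trans
      (.glue_beta h.equiv (h.fiberExt_cover hφψ hw) (h.base.el.pathFill_one ha (fiber_snd hw))
        (h.fiberExt_cover_eq hφψ ha hw))))

theorem fiberExt (hφψ : φ ≤ ψ) (h : GlueData Γ φ T e A) (ha : Stable Γ (tm a A))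
    (hw : Stable (Γ.face ψ) (tm w (glueFiber φ T e A a))) :
    Stable Γ (tm (Tm.fiberExt φ A ψ w a) (glueFiber φ T e A a)) :=
  h.glue_univ.el.pair (h.fiber_body_ty ha) (h.fiberExt_fst hφψ ha hw)
    ((h.fiberExt_snd hφψ ha hw).cast (fiber_body_inst _ _ _ _).symm)

/-- The face ψ may be larger than φ, so the equation of `Glue` on φ does not suffice. On ψ the base
of the glued point is `unglue` of `w.1`, and η for glueing identifies that point with `w.1`; the
paths then agree by η. -/
theorem fiberExt_eq (hψ : Γ.restr ≤ ψ) (hφψ : φ ≤ ψ) (h : GlueData Γ φ T e A)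
    (ha : Stable Γ (tm a A)) (hw : Stable (Γ.face ψ) (tm w (glueFiber φ T e A a))) :
    Stable Γ (tmEq (Tm.fiberExt φ A ψ w a) w (glueFiber φ T e A a)) := by
  have hw' := hw.restrict (Δ := Γ) (le_inf le_rfl hψ)
  have hfst : Stable Γ (tmEq (.glue φ (.fst w) ((Tm.pathFill A ψ (.snd w) a).dinst ⊤))
      (.fst w) (.Glue φ T e A)) :=
    (Stable.glue_congr h.equiv (h.fiberExt_cover hφψ hw).refl (h.fiberExt_base_eq hψ ha hw)
      (h.fiberExt_cover_eq hφψ ha hw)).trans hw'.fst.glue_eta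
  refine (h.glue_univ.el.pair_congr (h.fiber_body_ty ha) hfst ?_).trans
    (h.glue_univ.el.pair_eta (h.fiber_body_ty ha) hw')
  refine .castEq ?_ (fiber_body_inst _ _ _ _).symm
  refine .path_eta (h.fiberExt_snd hφψ ha hw) ((fiber_snd hw').conv (.path_congr
    h.base.el.ty_refl ha.refl (.arrow_app_congr h.unglueMap.refl hfst.symm))) ?_
  have hp := h.base.el.pathFill ha (fiber_snd hw)
  have hb := h.base.el.wkD.path_beta (.var 0) (hp.ren (Ctx.Ren.succDim Γ).liftDim |>.cast
    (wkD_ren _ _ _))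
  refine .trans (hb.trans ?_) (h.base.el.pathFill_eq hψ ha (fiber_snd hw))
  rw [ren_liftDim_dinst]
  exact hp.refl

end GlueData

end Glueing

section Univalence

variable {n n' m m' : ℕ}

/-! ### Partial elements given by two end points -/

/-- `[(i = 0) ↦ x, (i = 1) ↦ y]`, for a new name `i`. -/
def Tm.ends (x y : Tm n m) : Tm n (m + 1) :=
  sys 2 ![Face.eq0 0, Face.eq1 0] ![x.wkD, y.wkD]

/-- `(i = 0) ∨ (i = 1)` for the last name `i`. -/
def Face.boundary : Face (m + 1) := Face.eq0 0 ⊔ Face.eq1 0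

namespace Stable

variable {X x y p : Tm n m}

/-- The two parts live on disjoint faces, so their compatibility is vacuous. The context Δ is left
free so that the lemma applies whatever the order of its restrictions. -/
theorem ends {Γ : Ctx n m} {Δ : Ctx n (m + 1)} (hX : Stable Γ (ty X)) (hx : Stable Γ (tm x X))
    (hy : Stable Γ (tm y X)) (hΔ : Δ.restr ≤ Γ.dim.restr ⊓ Face.boundary)
    (hl : ∀ z, Δ.lookup z = Γ.dim.lookup z := by exact fun _ => rfl) :
    Stable Δ (tm (Tm.ends x y) X.wkD) := by
  have hr := hΔ.trans inf_le_left
  refine (hX.wkD.restrict hr hl).sys_two (hΔ.trans inf_le_right) (hx.wkD.restrict hr hl).face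
    (hy.wkD.restrict hr hl).face (.of_le_bot ?_)
  rw [Face.eq0_inf_eq1]
  exact inf_le_right

theorem ends_zero {Γ : Ctx n m} {Δ : Ctx n (m + 1)} (hX : Stable Γ (ty X))
    (hx : Stable Γ (tm x X)) (hy : Stable Γ (tm y X))
    (hΔ : Δ.restr ≤ Γ.dim.restr ⊓ Face.eq0 0)
    (hl : ∀ z, Δ.lookup z = Γ.dim.lookup z := by exact fun _ => rfl) :
    Stable Δ (tmEq (Tm.ends x y) x.wkD X.wkD) :=
  (ends hX hx hy (hΔ.trans (inf_le_inf_left _ le_sup_left)) hl).sys_eq 0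
    (hΔ.trans inf_le_right)

theorem ends_one {Γ : Ctx n m} {Δ : Ctx n (m + 1)} (hX : Stable Γ (ty X))
    (hx : Stable Γ (tm x X)) (hy : Stable Γ (tm y X))
    (hΔ : Δ.restr ≤ Γ.dim.restr ⊓ Face.eq1 0)
    (hl : ∀ z, Δ.lookup z = Γ.dim.lookup z := by exact fun _ => rfl) :
    Stable Δ (tmEq (Tm.ends x y) y.wkD X.wkD) :=
  (ends hX hx hy (hΔ.trans (inf_le_inf_left _ le_sup_right)) hl).sys_eq 1
    (hΔ.trans inf_le_right)

/-- Supplies the compatibility of the two parts of `pathSys`. -/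
theorem papp_eq_ends {Γ : Ctx n m} {Δ : Ctx n (m + 1)} (hX : Stable Γ (ty X))
    (hx : Stable Γ (tm x X)) (hy : Stable Γ (tm y X)) (hp : Stable Γ (tm p (.path X x y)))
    (hΔ : Δ.restr ≤ Γ.dim.restr ⊓ Face.boundary)
    (hl : ∀ z, Δ.lookup z = Γ.dim.lookup z := by exact fun _ => rfl) :
    Stable Δ (tmEq (.papp p.wkD (.var 0)) (Tm.ends x y) X.wkD) := by
  have hr := hΔ.trans inf_le_left
  refine .cover (hΔ.trans inf_le_right) ?_ ?_
  · exact (papp_isZero inf_le_right (hp.wkD.restrict hr hl).face).trans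
      (ends_zero (Δ := Δ.face (Face.eq0 0)) hX hx hy (inf_le_inf_right _ hr) hl).symm
  · exact (papp_isOne inf_le_right (hp.wkD.restrict hr hl).face).trans
      (ends_one (Δ := Δ.face (Face.eq1 0)) hX hx hy (inf_le_inf_right _ hr) hl).symm

end Stable

/-! ### Extending partial proofs of contractibility of the fibers of `unglue` -/

/-- The partial element `[φ ↦ p i, (i = 0) ↦ c, (i = 1) ↦ v]`. -/
def Tm.pathSys (φ : Face m) (p c v : Tm n m) : Tm n (m + 1) :=
  sys 2 ![φ.wk, Face.boundary] ![papp p.wkD (.var 0), ends c v]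

/-- The extension of a partial path `p` from `c` to `v` in the fiber of `unglue` over `a`. -/
def Tm.fiberPath (φ : Face m) (A p c v a : Tm n m) : Tm n (m + 1) :=
  fiberExt φ.wk A.wkD (φ.wk ⊔ Face.boundary) (pathSys φ p c v) a.wkD

/-- The extension of a partial proof `q` that the fiber of `unglue` over `a` is contractible. -/
def Tm.fiberContr (φ : Face m) (T e A q a : Tm n m) : Tm n m :=
  let c := fiberExt φ A φ (fst q) a
  pair c (lam (glueFiber φ T e A a)
    (plam (fiberPath φ A.wk (app (snd q).wk (var 0)) c.wk (var 0) a.wk)))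

namespace GlueData

variable {Γ : Ctx n m} {φ ψ : Face m} {T e A a b c q p v w : Tm n m}

theorem pathSys {Δ : Ctx n (m + 1)} (h : GlueData Γ φ T e A) (ha : Stable Γ (tm a A))
    (hc : Stable Γ (tm c (glueFiber φ T e A a))) (hv : Stable Γ (tm v (glueFiber φ T e A a)))
    (hp : Stable (Γ.face φ) (tm p (.path (glueFiber φ T e A a) c v)))
    (hΔ : Δ.restr ≤ Γ.dim.restr ⊓ (φ.wk ⊔ Face.boundary))
    (hl : ∀ z, Δ.lookup z = Γ.dim.lookup z := by exact fun _ => rfl) :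
    Stable Δ (tm (Tm.pathSys φ p c v) (glueFiber φ T e A a).wkD) := by
  have hr := hΔ.trans inf_le_left
  have hφ : Γ.dim.restr ⊓ φ.wk ≤ (Γ.face φ).dim.restr := by
    simp only [Ctx.restr, Face.wk, Face.subst_inf, le_refl]
  refine ((h.fiber_ty ha).wkD.restrict hr hl).sys_two (hΔ.trans inf_le_right) (.papp _
    (hp.wkD.restrict ((inf_le_inf_right _ hr).trans hφ) hl)) (.ends (h.fiber_ty ha) hc hv
    (inf_le_inf_right _ hr) hl) (.papp_eq_ends (h.fiber_ty ha).face hc.face hv.face hp ?_ hl)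
  change Δ.restr ⊓ (φ.wk ⊓ Face.boundary) ≤ (Γ.face φ).dim.restr ⊓ Face.boundary
  rw [← inf_assoc]
  exact inf_le_inf_right _ ((inf_le_inf_right _ hr).trans hφ)

theorem fiberPath (h : GlueData Γ φ T e A) (ha : Stable Γ (tm a A))
    (hc : Stable Γ (tm c (glueFiber φ T e A a))) (hv : Stable Γ (tm v (glueFiber φ T e A a)))
    (hp : Stable (Γ.face φ) (tm p (.path (glueFiber φ T e A a) c v))) :
    Stable Γ.dim (tm (Tm.fiberPath φ A p c v a) (glueFiber φ T e A a).wkD) := by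
  rw [glueFiber_wkD]
  exact h.wkD.fiberExt le_sup_left ha.wkD ((h.pathSys ha hc hv hp le_rfl).cast
    (glueFiber_wkD _ _ _ _ _))

theorem fiberPath_eq {Δ : Ctx n (m + 1)} (h : GlueData Γ φ T e A) (ha : Stable Γ (tm a A))
    (hc : Stable Γ (tm c (glueFiber φ T e A a))) (hv : Stable Γ (tm v (glueFiber φ T e A a)))
    (hp : Stable (Γ.face φ) (tm p (.path (glueFiber φ T e A a) c v)))
    (hΔ : Δ.restr ≤ Γ.dim.restr ⊓ (φ.wk ⊔ Face.boundary))
    (hl : ∀ z, Δ.lookup z = Γ.dim.lookup z := by exact fun _ => rfl) :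
    Stable Δ (tmEq (Tm.fiberPath φ A p c v a) (Tm.pathSys φ p c v)
      (glueFiber φ T e A a).wkD) := by
  have hr := hΔ.trans inf_le_left
  rw [glueFiber_wkD]
  exact (h.wkD.restrict hr hl).fiberExt_eq (hΔ.trans inf_le_right) le_sup_left
    (ha.wkD.restrict hr hl) ((h.pathSys (Δ := Δ.face (φ.wk ⊔ Face.boundary)) ha hc hv hp
    (inf_le_inf_right _ hr) hl).cast
    (glueFiber_wkD _ _ _ _ _))

/-- The face of definition contains both ends of the new name, so strictness of the extension fixes
the end points `c` and `v`. -/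
theorem plam_fiberPath (h : GlueData Γ φ T e A) (ha : Stable Γ (tm a A))
    (hc : Stable Γ (tm c (glueFiber φ T e A a))) (hv : Stable Γ (tm v (glueFiber φ T e A a)))
    (hp : Stable (Γ.face φ) (tm p (.path (glueFiber φ T e A a) c v))) :
    Stable Γ (tm (.plam (Tm.fiberPath φ A p c v a)) (.path (glueFiber φ T e A a) c v)) := by
  have h0 : (Face.eq0 0 : Face (m + 1)) ≤ φ.wk ⊔ Face.boundary :=
    le_sup_left.trans le_sup_right
  have h1 : (Face.eq1 0 : Face (m + 1)) ≤ φ.wk ⊔ Face.boundary :=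
    le_sup_right.trans le_sup_right
  have hF := h.fiber_ty ha
  refine hF.plam (h.fiberPath ha hc hv hp) (.dinst_zero ?_) (.dinst_one ?_)
  · exact (h.fiberPath_eq ha hc hv hp (inf_le_inf_left _ h0)).trans
      (((h.pathSys ha hc hv hp (inf_le_inf_left _ h0)).sys_eq 1
        (inf_le_right.trans le_sup_left)).trans (.ends_zero hF hc hv le_rfl))
  · exact (h.fiberPath_eq ha hc hv hp (inf_le_inf_left _ h1)).trans
      (((h.pathSys ha hc hv hp (inf_le_inf_left _ h1)).sys_eq 1
        (inf_le_right.trans le_sup_right)).trans (.ends_one hF hc hv le_rfl))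

theorem plam_fiberPath_eq (hφ : Γ.restr ≤ φ) (h : GlueData Γ φ T e A) (ha : Stable Γ (tm a A))
    (hc : Stable Γ (tm c (glueFiber φ T e A a))) (hv : Stable Γ (tm v (glueFiber φ T e A a)))
    (hp : Stable (Γ.face φ) (tm p (.path (glueFiber φ T e A a) c v))) :
    Stable Γ (tmEq (.plam (Tm.fiberPath φ A p c v a)) p (.path (glueFiber φ T e A a) c v)) := by
  have hφ' : Γ.dim.restr ≤ φ.wk := Face.subst_mono _ hφ
  have hΔ : Γ.dim.restr ≤ Γ.dim.restr ⊓ (φ.wk ⊔ Face.boundary) :=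
    le_inf le_rfl (hφ'.trans le_sup_left)
  have hl := h.fiberPath ha hc hv hp
  refine .path_eta (h.plam_fiberPath ha hc hv hp) (hp.restrict (le_inf le_rfl hφ)) ?_
  have hb := (h.fiber_ty ha).wkD.path_beta (.var 0) (hl.ren (Ctx.Ren.succDim Γ).liftDim |>.cast
    (wkD_ren _ _ _))
  rw [ren_liftDim_dinst] at hb
  exact hb.trans ((h.fiberPath_eq ha hc hv hp hΔ).trans
    ((h.pathSys ha hc hv hp hΔ).sys_eq 0 hφ'))

theorem fiberContr_center (h : GlueData Γ φ T e A) (ha : Stable Γ (tm a A))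
    (hq : Stable (Γ.face φ) (tm q (isContr (glueFiber φ T e A a)))) :
    Stable Γ (tm (Tm.fiberExt φ A φ (.fst q) a) (glueFiber φ T e A a)) :=
  h.fiberExt le_rfl ha hq.isContr_fst

theorem fiberContr_center_eq (hφ : Γ.restr ≤ φ) (h : GlueData Γ φ T e A)
    (ha : Stable Γ (tm a A)) (hq : Stable (Γ.face φ) (tm q (isContr (glueFiber φ T e A a)))) :
    Stable Γ (tmEq (Tm.fiberExt φ A φ (.fst q) a) (.fst q) (glueFiber φ T e A a)) :=
  h.fiberExt_eq hφ le_rfl ha hq.isContr_fst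

/-- The path given by `q` starts at `q.1`, whereas one from the extended centre is wanted. The two
points are equal on φ, so a conversion suffices. -/
theorem fiberContr_path (h : GlueData Γ φ T e A) (ha : Stable Γ (tm a A))
    (hq : Stable (Γ.face φ) (tm q (isContr (glueFiber φ T e A a)))) :
    Stable ((Γ.tm (glueFiber φ T e A a)).face φ) (tm (.app (Tm.snd q).wk (.var 0))
      (.path (glueFiber φ T e A a).wk (Tm.fiberExt φ A φ (.fst q) a).wk (.var 0))) := by
  have hF := (h.fiber_ty ha).face (φ := φ)
  have hq' : Stable ((Γ.face φ).tm (glueFiber φ T e A a))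
      (tm q.wk (isContr (glueFiber φ T e A a).wk)) := hq.wk.cast (isContr_ren _ _ _)
  have hc : Stable ((Γ.face φ).tm (glueFiber φ T e A a)) (tmEq (Tm.fst q).wk
      (Tm.fiberExt φ A φ (.fst q) a).wk (glueFiber φ T e A a).wk) :=
    (h.face.fiberContr_center_eq inf_le_right ha.face
      (hq.restrict (inf_le_inf_right _ inf_le_left))).symm.wk
  exact ((hq'.isContr_path .var_zero).conv (.path_congr hF.wk.ty_refl hc
    Stable.var_zero.refl)).restrict le_rfl

theorem fiberContr_homotopy (h : GlueData Γ φ T e A) (ha : Stable Γ (tm a A))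
    (hq : Stable (Γ.face φ) (tm q (isContr (glueFiber φ T e A a)))) :
    Stable (Γ.tm (glueFiber φ T e A a)) (tm (.plam (Tm.fiberPath φ A.wk
      (.app (Tm.snd q).wk (.var 0)) (Tm.fiberExt φ A φ (.fst q) a).wk (.var 0) a.wk))
      (.path (glueFiber φ T e A a).wk (Tm.fiberExt φ A φ (.fst q) a).wk (.var 0))) := by
  have hp := h.fiberContr_path ha hq
  have hc := (h.fiberContr_center ha hq).wk (A := glueFiber φ T e A a)
  have hv := Stable.var_zero (Γ := Γ) (A := glueFiber φ T e A a)
  have e' := glueFiber_wk φ T e A a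
  simp only [e'] at hp hv ⊢
  exact h.wk.plam_fiberPath ha.wk (hc.cast e') hv hp

theorem fiberContr_homotopy_eq (hφ : Γ.restr ≤ φ) (h : GlueData Γ φ T e A)
    (ha : Stable Γ (tm a A)) (hq : Stable (Γ.face φ) (tm q (isContr (glueFiber φ T e A a)))) :
    Stable (Γ.tm (glueFiber φ T e A a)) (tmEq (.plam (Tm.fiberPath φ A.wk
      (.app (Tm.snd q).wk (.var 0)) (Tm.fiberExt φ A φ (.fst q) a).wk (.var 0) a.wk))
      (.app (Tm.snd q).wk (.var 0))
      (.path (glueFiber φ T e A a).wk (Tm.fiberExt φ A φ (.fst q) a).wk (.var 0))) := by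
  have hp := h.fiberContr_path ha hq
  have hc := (h.fiberContr_center ha hq).wk (A := glueFiber φ T e A a)
  have hv := Stable.var_zero (Γ := Γ) (A := glueFiber φ T e A a)
  have e' := glueFiber_wk φ T e A a
  simp only [e'] at hp hv ⊢
  exact h.wk.plam_fiberPath_eq hφ ha.wk (hc.cast e') hv hp

theorem fiberContr (h : GlueData Γ φ T e A) (ha : Stable Γ (tm a A))
    (hq : Stable (Γ.face φ) (tm q (isContr (glueFiber φ T e A a)))) :
    Stable Γ (tm (Tm.fiberContr φ T e A q a) (isContr (glueFiber φ T e A a))) :=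
  (h.fiber_ty ha).isContr_intro (h.fiberContr_center ha hq) (h.fiberContr_homotopy ha hq)

theorem fiberContr_eq (hφ : Γ.restr ≤ φ) (h : GlueData Γ φ T e A) (ha : Stable Γ (tm a A))
    (hq : Stable (Γ.face φ) (tm q (isContr (glueFiber φ T e A a)))) :
    Stable Γ (tmEq (Tm.fiberContr φ T e A q a) q (isContr (glueFiber φ T e A a))) :=
  (h.fiber_ty ha).isContr_eq (h.fiberContr_center_eq hφ ha hq) (h.fiberContr_homotopy ha hq)
    (hq.restrict (le_inf le_rfl hφ)) (h.fiberContr_homotopy_eq hφ ha hq)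

end GlueData

/-! ### Extending partial equivalences -/

/-- The proof that `unglue` is an equivalence, which is `e.2` on `φ`. -/
def Tm.unglueIsEquiv (φ : Face m) (T e A : Tm n m) : Tm n m :=
  lam A (fiberContr φ T.wk e.wk A.wk (app (snd e).wk (var 0)) (var 0))

/-- The extension to the whole context of a pair `(T, e)` defined on `φ`, where
`e : Equiv T A`. -/
def Tm.equivExt (φ : Face m) (T e A : Tm n m) : Tm n m :=
  pair (Glue φ T e A) (pair (unglueMap φ T e A) (unglueIsEquiv φ T e A))

/-- `(X : U) × Equiv X A`. -/
def Tm.equivsTo (A : Tm n m) : Tm n m := sigma univ (equiv (var 0) A.wk)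

namespace GlueData

variable {Γ : Ctx n m} {φ : Face m} {T e A : Tm n m}

theorem isEquiv_fiber_eq (φ : Face m) (T e A : Tm n m) :
    fiber (Tm.Glue φ T e A).wk A.wk (Tm.unglueMap φ T e A).wk (.var 0) =
      glueFiber φ T.wk e.wk A.wk (.var 0) := by
  simp only [glueFiber, Tm.wk, unglueMap_ren, Tm.ren, Face.subst_var]

/-- On φ, `e.2 y` speaks of the fiber of `e.1`, which there equals the fiber of `unglue`. -/
theorem equiv_fiber_contr (h : GlueData Γ φ T e A) :
    Stable ((Γ.tm A).face φ) (tm (.app (Tm.snd e).wk (.var 0))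
      (isContr (glueFiber φ T.wk e.wk A.wk (.var 0)))) := by
  have hv : Stable ((Γ.tm A).face φ) (tm (.var 0) A.wk) := Stable.var_zero.face
  refine (h.wk.equiv.equiv_contr hv).conv (.ty_symm ?_)
  exact (h.wk.face.fiber_ty hv).isContr_congr (h.wk.face.fiber_eq inf_le_right hv)

theorem unglueIsEquiv (h : GlueData Γ φ T e A) :
    Stable Γ (tm (Tm.unglueIsEquiv φ T e A)
      (isEquiv (.Glue φ T e A) A (Tm.unglueMap φ T e A))) := by
  rw [isEquiv, isEquiv_fiber_eq]
  exact h.base.el.lam (h.wk.fiberContr .var_zero h.equiv_fiber_contr)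

/-- Inherited pointwise from `fiberContr_eq`, then by η for functions. -/
theorem unglueIsEquiv_eq (hφ : Γ.restr ≤ φ) (h : GlueData Γ φ T e A) :
    Stable Γ (tmEq (Tm.unglueIsEquiv φ T e A) (.snd e)
      (isEquiv (.Glue φ T e A) A (Tm.unglueMap φ T e A))) := by
  have he := (h.equiv.restrict (Δ := Γ) (le_inf le_rfl hφ)).equiv_snd.conv
    (.ty_symm (.isEquiv_congr h.glue_univ.el (h.glue_eq hφ).el_congr h.base.el h.unglueMap
      (h.unglueMap_eq hφ)))
  rw [isEquiv, isEquiv_fiber_eq] at he ⊢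
  exact h.base.el.lam_eq (h.wk.fiberContr .var_zero h.equiv_fiber_contr) he
    (h.wk.fiberContr_eq hφ .var_zero h.equiv_fiber_contr)

end GlueData

namespace Stable

variable {Γ : Ctx n m} {φ : Face m} {T e A X : Tm n m}

theorem equivsTo_body_ty (hA : Stable Γ (tm A .univ)) :
    Stable (Γ.tm .univ) (ty (equiv (.var 0) A.wk)) :=
  equiv_ty (el (var_zero (A := .univ))) hA.wk.el

theorem equivsTo_ty (hA : Stable Γ (tm A .univ)) : Stable Γ (ty (equivsTo A)) :=
  univ.sigma hA.equivsTo_body_ty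

/-- Turns a partial element of `(X : U) × Equiv X A` into the input of a glueing, which is why
glueing extends it. -/
theorem equivsTo_glueData (hA : Stable Γ (tm A .univ))
    (hX : Stable (Γ.face φ) (tm X (equivsTo A))) : GlueData Γ φ (.fst X) (.snd X) A :=
  ⟨hA, hX.fst, hX.snd.cast (equiv_var_inst _ _)⟩

end Stable

namespace GlueData

variable {Γ : Ctx n m} {φ : Face m} {T e A : Tm n m}

theorem equivExt (h : GlueData Γ φ T e A) :
    Stable Γ (tm (Tm.equivExt φ T e A) (equivsTo A)) := by
  have hG := h.glue_univ.el
  refine Stable.univ.pair h.base.equivsTo_body_ty h.glue_univ (.cast ?_ (equiv_var_inst _ _).symm)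
  exact (hG.arrow_ty h.base.el).pair (hG.equiv_body_ty h.base.el) h.unglueMap
    (h.unglueIsEquiv.cast (equiv_body_inst _ _ _).symm)

/-- The equality is definitional in all three components: the type, the map and the proof that it is
an equivalence. The last is the reason for extending `e.2` rather than giving an unrelated proof. -/
theorem equivExt_eq (hφ : Γ.restr ≤ φ) (h : GlueData Γ φ T e A) :
    Stable Γ (tmEq (Tm.equivExt φ T e A) (.pair T e) (equivsTo A)) := by
  have hG := h.glue_univ.el
  have he := (h.equiv.restrict (Δ := Γ) (le_inf le_rfl hφ)).conv
    (.ty_symm (hG.equiv_congr (h.glue_eq hφ).el_congr h.base.el))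
  refine Stable.univ.pair_congr h.base.equivsTo_body_ty (h.glue_eq hφ)
    (.castEq ?_ (equiv_var_inst _ _).symm)
  exact ((hG.arrow_ty h.base.el).pair_congr (hG.equiv_body_ty h.base.el) (h.unglueMap_eq hφ)
    ((h.unglueIsEquiv_eq hφ).castEq (equiv_body_inst _ _ _).symm)).trans
    ((hG.arrow_ty h.base.el).pair_eta (hG.equiv_body_ty h.base.el) he)

end GlueData

/-! ### Contractibility of the type of equivalences to a given type -/

/-- The extension of the empty partial element of `(X : U) × Equiv X A`. -/
def Tm.equivsToCenter (A : Tm n m) : Tm n m :=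
  equivExt ⊥ (fst (sys 0 ![] ![])) (snd (sys 0 ![] ![])) A

/-- A line in `(X : U) × Equiv X A` from `x` to `y`. -/
def Tm.equivsToLine (A x y : Tm n m) : Tm n (m + 1) :=
  equivExt Face.boundary (fst (ends x y)) (snd (ends x y)) A.wkD

theorem Tm.equivsTo_ren (ξ : Fin n → Fin n') (ρ : Fin m → Dim m') (A : Tm n m) :
    (equivsTo A).ren ξ ρ = equivsTo (A.ren ξ ρ) := by
  simp [equivsTo, equiv_ren]

theorem Tm.equivsTo_subst (σ : Fin n → Tm n' m') (ρ : Fin m → Dim m') (A : Tm n m) :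
    (equivsTo A).subst σ ρ = equivsTo (A.subst σ ρ) := by
  simp only [equivsTo, subst, equiv_subst, wk_subst]
  rfl

namespace Stable

variable {Γ : Ctx n m} {A x y : Tm n m}

/-- The partial data come from the empty system, well typed because the face `⊥` makes the context
absurd. -/
theorem equivsToCenter (hA : Stable Γ (tm A .univ)) :
    Stable Γ (tm (Tm.equivsToCenter A) (equivsTo A)) :=
  (hA.equivsTo_glueData (.of_le_bot inf_le_right)).equivExt

theorem equivsTo_path (hA : Stable Γ (tm A .univ)) (hx : Stable Γ (tm x (equivsTo A)))
    (hy : Stable Γ (tm y (equivsTo A))) :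
    Stable Γ (tm (.plam (Tm.equivsToLine A x y)) (.path (equivsTo A) x y)) := by
  have hS := hA.equivsTo_ty
  have hwk : (equivsTo A).wkD = equivsTo A.wkD := equivsTo_ren _ _ _
  have h := hA.wkD.equivsTo_glueData
    ((ends (Δ := Γ.dim.face Face.boundary) hS hx hy le_rfl).cast hwk)
  -- On the boundary the line is the pair of projections of `ends x y`, which is `ends x y` by
  -- surjective pairing.
  have key {ψ : Face (m + 1)} (hψ : ψ ≤ Face.boundary) : Stable (Γ.dim.face ψ)
      (tmEq (Tm.equivsToLine A x y) (Tm.ends x y) (equivsTo A).wkD) := by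
    have hY := ends (Δ := Γ.dim.face ψ) hS hx hy (inf_le_inf_left _ hψ)
    rw [hwk] at hY ⊢
    exact (h.face.equivExt_eq (inf_le_right.trans hψ)).trans
      (univ.pair_eta (hA.wkD.face).equivsTo_body_ty hY)
  refine hS.plam (h.equivExt.cast hwk.symm) (.dinst_zero ?_) (.dinst_one ?_)
  · exact (key le_sup_left).trans (ends_zero hS hx hy le_rfl)
  · exact (key le_sup_right).trans (ends_one hS hx hy le_rfl)

/-- Any two elements are joined by a line, in particular the centre and a generic element. -/
theorem equivsTo_isContr (hA : Stable Γ (tm A .univ)) :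
    Stable Γ (tm (.pair (Tm.equivsToCenter A) (.lam (equivsTo A)
      (.plam (Tm.equivsToLine A.wk (Tm.equivsToCenter A).wk (.var 0)))))
      (isContr (equivsTo A))) := by
  have hwk : (equivsTo A).wk = equivsTo A.wk := equivsTo_ren _ _ _
  refine hA.equivsTo_ty.isContr_intro hA.equivsToCenter ?_
  have hc := hA.equivsToCenter.wk (A := equivsTo A)
  have hv := var_zero (Γ := Γ) (A := equivsTo A)
  rw [hwk] at hv ⊢
  exact hA.wk.equivsTo_path (hc.cast hwk) hv

end Stable

end Univalence

end Cubical

/-- If `Γ ⊢ A : U`, then `isContr ((X : U) × Equiv X A)` has an element in context `Γ`. -/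
theorem mainTheorem3 {n m : ℕ} (Γ : Cubical.Ctx n m) (A : Cubical.Tm n m)
    (hA : Cubical.Der Γ (Cubical.Judgment.tm A Cubical.Tm.univ)) :
    ∃ t : Cubical.Tm n m,
      Cubical.Der Γ (Cubical.Judgment.tm t
        (Cubical.Tm.isContr
          (Cubical.Tm.sigma Cubical.Tm.univ
            (Cubical.Tm.equiv (Cubical.Tm.var 0) A.wk)))) := by
  -- The result for a variable of type `U`, abstracted: the variable is stably typed, while `A` is
  -- only known to be derivable.
  have h := Cubical.Stable.lam (Γ := Γ) Cubical.Stable.univ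
    (Cubical.Stable.equivsTo_isContr (A := .var 0) Cubical.Stable.var_zero)
  have h := Cubical.Der.app (h.der hA.derivable.der) hA
  -- Substituting `A` for the variable in the type of the application gives the required type.
  rw [Cubical.Tm.inst, Cubical.Tm.isContr_subst, Cubical.Tm.equivsTo_subst] at h
  exact ⟨_, h⟩
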